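/- **Haiman's lattices.** Let $F$ be a field with $|F|>2$, let $n\ge 3$ and $a\in F\setminus\{0,1\}$. Let $F^{2n}$ have basis $\alpha_i,\beta_i$ ($i\in\mathbb Z/n$, indices computed modulo $n$), and put $$m=\langle \alpha_j : j\in\mathbb Z/n\rangle,\quad p_i=\langle \alpha_j : j\neq i,i+1\rangle,\quad r_i=m+\langle\beta_i\rangle,\quad q_i=\langle\alpha_j : j\ne i\rangle,\quad s_i=m+\langle\beta_{i-1},\beta_i\rangle .$$ The elements of $\mathbf H_n(F)$ (with twisting parameter $a$) are the subspaces of $F^{2n}$ that lie in at least one of the intervals $[0,m]$, $[m,F^{2n}]$, $[p_i,r_i]$, $[q_i,s_i]$ ($i\in\mathbb Z/n$). Let $\varphi$ be the linear automorphism with $\varphi(\beta_0)=a\beta_0$ that fixes all other basis vectors. The order of $\mathbf H_n(F)$ is inclusion, except that for $x\not\supseteq m$ and $y\supseteq m$ one puts $x\le y$ if and only if $\tau(x+m)\subseteq y$, where $\tau(z)=\varphi(z)$ if $z\subseteq s_0$ and $\tau(z)=z$ otherwise. (That is, the union of these intervals is reglued, with the interval $[m,F^{2n}]$ attached to $[q_0,s_0]$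 through $\varphi$.) This is a lattice; the lattices $\mathbf H_n(F)$ obtained from all such $F$, $n$, $a$ are called *Haiman's lattices*. **Planes.** A subspace of a projective plane is a set of points that contains, with any two distinct points of a line, all points of that line. A plane is nonarguesian (non-Desarguesian) if Desargues' theorem fails in it: there are a point $o$, three distinct lines $l_0,l_1,l_2$ through $o$ and points $a_i\ne b_i$ on $l_i$, all different from $o$, such that $a_0,a_1,a_2$ are not collinear, $b_0,b_1,b_2$ are not collinear, and the three intersection points of the corresponding sides $a_ja_k$ and $b_jb_k$ are not collinear. **Varieties.** For congruences $\alpha,\beta,\delta$ of an algebra $\mathbf A$, $\operatorname C(\alpha,\beta;\delta)$ means: for every term $t(\bar x,\bar y)$ and all tuples $\bar a\mathrel\alpha\bar b$, $\bar c\mathrel\beta\bar d$, if $t(\bar a,\bar c)\mathrel\delta t(\bar a,\bar d)$, then $t(\bar b,\bar c)\mathrel\delta t(\bar b,\bar d)$. The commutator $[\alpha,\beta]$ is the least $\delta$ with $\operatorname C(\alpha,\beta;\delta)$. A variety $\mathscr V$ has a *weak difference term* if there is a ternary term $d$ such that for every $\mathbf A\in\mathscr V$, every congruence $\theta$ of $\mathbf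 A$ and all $(a,b)\in\theta$ we have $a\mathrel{[\theta,\theta]}d(a,b,b)$ and $d(a,a,b)\mathrel{[\theta,\theta]}b$. **Theorem.** Let $L$ be one of Haiman's lattices or the lattice of subspaces of a nonarguesian projective plane, and let $\mathscr V$ be a variety of algebras with a weak difference term. Then $L\notin \mathbf S\,\mathbf{Con}(\mathscr V)$; that is, $L$ is not isomorphic to a sublattice of the congruence lattice of any member of $\mathscr V$. -/

import Mathlib

set_option linter.unnecessarySeqFocus false

universe u v w x y z

/-! ## Universal algebra: congruences, the commutator, weak difference terms, varieties -/

section UniversalAlgebra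


/-- A congruence of the algebra `A`: an equivalence relation preserved by all basic operations. -/
@[ext]
structure AlgCon (S : FirstOrder.Language.{u, v}) (A : Type w) [S.Structure A] extends Setoid A where
  map_fun : ∀ {n : ℕ} (f : S.Functions n) (x y : Fin n → A),
    (∀ i, toSetoid (x i) (y i)) →
      toSetoid (FirstOrder.Language.Structure.funMap f x) (FirstOrder.Language.Structure.funMap f y)

namespace AlgCon

/-- Congruences are ordered by inclusion. -/
instance instPartialOrder (S : FirstOrder.Language.{u, v}) (A : Type w) [S.Structure A] :
    PartialOrder (AlgCon S A) :=
  PartialOrder.lift AlgCon.toSetoid (fun _ _ h => AlgCon.ext (congrArg (fun s : Setoid A => (s : A → A → Prop)) h))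

/-- The meet of a set of congruences is its intersection. -/
instance instInfSet (S : FirstOrder.Language.{u, v}) (A : Type w) [S.Structure A] :
    InfSet (AlgCon S A) where
  sInf T :=
    { r := fun a b => ∀ θ ∈ T, θ.toSetoid a b
      iseqv := ⟨fun a θ _ => θ.refl' a, fun h θ hθ => θ.symm' (h θ hθ),
        fun h k θ hθ => θ.trans' (h θ hθ) (k θ hθ)⟩
      map_fun := fun f x y h θ hθ => θ.map_fun f x y (fun i => h i θ hθ) }

/-- The congruence lattice of the algebra `A`. -/
instance instCompleteLattice (S : FirstOrder.Language.{u, v}) (A : Type w) [S.Structure A] :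
    CompleteLattice (AlgCon S A) :=
  completeLatticeOfInf (AlgCon S A) (fun T => by
    constructor
    · intro θ hθ a b h
      exact h θ hθ
    · intro δ hδ a b h θ hθ
      exact hδ hθ h)

end AlgCon

/-- The centrality relation `C(α, β; δ)` (the term condition): for every term `t(x, y)` and all
tuples `a α b`, `c β d`, if `t(a, c) δ t(a, d)` then `t(b, c) δ t(b, d)`. -/
def Centralizes {S : FirstOrder.Language.{u, v}} {A : Type w} [S.Structure A] (α β δ : AlgCon S A) : Prop :=
  ∀ (m n : ℕ) (t : S.Term (Fin m ⊕ Fin n)) (a b : Fin m → A) (c d : Fin n → A),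
    (∀ i, α.toSetoid (a i) (b i)) → (∀ j, β.toSetoid (c j) (d j)) →
    δ.toSetoid (t.realize (Sum.elim a c)) (t.realize (Sum.elim a d)) →
      δ.toSetoid (t.realize (Sum.elim b c)) (t.realize (Sum.elim b d))

/-- The term condition commutator `[α, β]`: the least `δ` with `C(α, β; δ)`. -/
def algCommutator {S : FirstOrder.Language.{u, v}} {A : Type w} [S.Structure A] (α β : AlgCon S A) :
    AlgCon S A :=
  sInf {δ | Centralizes α β δ}

theorem algCommutator_isLeast {S : FirstOrder.Language.{u, v}} {A : Type w} [S.Structure A]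
    (α β : AlgCon S A) : IsLeast {δ | Centralizes α β δ} (algCommutator α β) :=
  ⟨fun m n t a b c d hab hcd h δ hδ => hδ m n t a b c d hab hcd (h δ hδ), fun _ hδ => sInf_le hδ⟩

/-- The ternary term `d` is a weak difference term for the algebra `A`. -/
def IsWeakDifferenceTerm {S : FirstOrder.Language.{u, v}} (d : S.Term (Fin 3)) (A : Type w)
    [S.Structure A] : Prop :=
  ∀ (θ : AlgCon S A) (a b : A), θ.toSetoid a b →
    (algCommutator θ θ).toSetoid a (d.realize ![a, b, b]) ∧
    (algCommutator θ θ).toSetoid (d.realize ![a, a, b]) b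

/-- The algebra `A` satisfies all equations in `E`, i.e. `A` is a member of the variety
axiomatized by `E`. -/
def InVariety {S : FirstOrder.Language.{u, v}} (E : Set (S.Term ℕ × S.Term ℕ)) (A : Type w)
    [S.Structure A] : Prop :=
  ∀ e ∈ E, ∀ x : ℕ → A, e.1.realize x = e.2.realize x

/-- The variety axiomatized by `E` has a weak difference term: one term that is a weak difference
term for every member of the variety. -/
def HasWeakDifferenceTerm {S : FirstOrder.Language.{u, v}} (E : Set (S.Term ℕ × S.Term ℕ)) : Prop :=
  ∃ d : S.Term (Fin 3), ∀ (A : Type w) [S.Structure A], InVariety E A → IsWeakDifferenceTerm d A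

/-- `L ∈ S Con(𝒱)` for the variety `𝒱` axiomatized by `E`: the lattice `L` is isomorphic to a
sublattice of the congruence lattice of some member of `𝒱`. -/
def InSCon {S : FirstOrder.Language.{u, v}} (E : Set (S.Term ℕ × S.Term ℕ)) (L : Type*) [Lattice L] : Prop :=
  ∃ (A : Type w) (_ : S.Structure A), InVariety E A ∧
    ∃ f : LatticeHom L (AlgCon S A), Function.Injective f

end UniversalAlgebra

/-! ## Projective planes -/

section Planes

/-- A subspace of a plane with points `P` and lines `Λ`: a set of points containing, with any two
distinct points of a line, all points of that line. -/
@[ext]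
structure PlaneSubspace (P Λ : Type*) [Membership P Λ] where
  carrier : Set P
  line_subset : ∀ (l : Λ) (x y : P), x ∈ carrier → y ∈ carrier → x ≠ y → x ∈ l → y ∈ l →
    ∀ z : P, z ∈ l → z ∈ carrier

/-- Subspaces are ordered by inclusion. -/
instance PlaneSubspace.instPartialOrder (P Λ : Type*) [Membership P Λ] :
    PartialOrder (PlaneSubspace P Λ) :=
  PartialOrder.lift PlaneSubspace.carrier (fun _ _ h => PlaneSubspace.ext h)

/-- The meet of a set of subspaces is its intersection. -/
instance PlaneSubspace.instInfSet (P Λ : Type*) [Membership P Λ] :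
    InfSet (PlaneSubspace P Λ) where
  sInf T :=
    { carrier := {x | ∀ U ∈ T, x ∈ U.carrier}
      line_subset := fun l x y hx hy hxy hxl hyl z hz U hU =>
        U.line_subset l x y (hx U hU) (hy U hU) hxy hxl hyl z hz }

/-- The lattice of subspaces of a plane. -/
instance PlaneSubspace.instCompleteLattice (P Λ : Type*) [Membership P Λ] :
    CompleteLattice (PlaneSubspace P Λ) :=
  completeLatticeOfInf (PlaneSubspace P Λ) (fun T => by
    constructor
    · intro U hU x hx
      exact hx U hU
    · intro W hW x hx U hU
      exact hW hU hx)

/-- Desargues' theorem holds in the plane: if two (nondegenerate) triangles `a`, `b` are in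
perspective from a point `o`, with corresponding vertices on three distinct lines through `o`,
then the intersection points of corresponding sides lie on a common line. Here `g i` and `h i`
are the sides of `a` and `b` opposite to the `i`-th vertex, and `c i` is their intersection. -/
def IsDesarguesian (P Λ : Type*) [Membership P Λ] : Prop :=
  ∀ (o : P) (l : Fin 3 → Λ) (a b : Fin 3 → P) (g h : Fin 3 → Λ) (c : Fin 3 → P),
    Function.Injective l →
    (∀ i, o ∈ l i ∧ a i ∈ l i ∧ b i ∈ l i ∧ a i ≠ o ∧ b i ≠ o ∧ a i ≠ b i) →
    (¬ ∃ k : Λ, ∀ i, a i ∈ k) → (¬ ∃ k : Λ, ∀ i, b i ∈ k) →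
    (∀ i j, j ≠ i → a j ∈ g i ∧ b j ∈ h i) →
    (∀ i, c i ∈ g i ∧ c i ∈ h i) →
    ∃ k : Λ, ∀ i, c i ∈ k

end Planes

/-! ## Haiman's lattices

The coordinate vectors of `F ^ (2n)` are written `α_i` (index `Sum.inl i`) and `β_i`
(index `Sum.inr i`), with `i` modulo `n`. -/

namespace Haiman

/-- The space `F ^ (2n)` with coordinates indexed by two copies of the integers modulo `n`. -/
abbrev Space (F : Type*) (n : ℕ) : Type _ := ZMod n ⊕ ZMod n → F

/-- The span of the coordinate vectors with index in `I`. -/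
def coord (F : Type*) [Field F] (n : ℕ) (I : Set (ZMod n ⊕ ZMod n)) :
    Submodule F (Space F n) where
  carrier := {v | ∀ k, k ∉ I → v k = 0}
  add_mem' := fun {v w} hv hw k hk => by simp [hv k hk, hw k hk]
  zero_mem' := fun k _ => rfl
  smul_mem' := fun c v hv k hk => by simp [hv k hk]

/-- Index set of `m = ⟨α_j : all j⟩`. -/
def mIdx (n : ℕ) : Set (ZMod n ⊕ ZMod n) := Set.range Sum.inl

/-- Index set of `p_i = ⟨α_j : j ≠ i, i + 1⟩`. -/
def pIdx (n : ℕ) (i : ZMod n) : Set (ZMod n ⊕ ZMod n) := Sum.inl '' {i, i + 1}ᶜ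

/-- Index set of `r_i = m + ⟨β_i⟩`. -/
def rIdx (n : ℕ) (i : ZMod n) : Set (ZMod n ⊕ ZMod n) := mIdx n ∪ {Sum.inr i}

/-- Index set of `q_i = ⟨α_j : j ≠ i⟩`. -/
def qIdx (n : ℕ) (i : ZMod n) : Set (ZMod n ⊕ ZMod n) := Sum.inl '' {i}ᶜ

/-- Index set of `s_i = m + ⟨β_{i-1}, β_i⟩`. -/
def sIdx (n : ℕ) (i : ZMod n) : Set (ZMod n ⊕ ZMod n) := mIdx n ∪ {Sum.inr (i - 1), Sum.inr i}

/-- The union of the intervals `[0, m]`, `[m, 1]`, `[p_i, r_i]` and `[q_i, s_i]` in the lattice of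
subspaces of `F ^ (2n)`. -/
def blocks (F : Type*) [Field F] (n : ℕ) : Set (Submodule F (Space F n)) :=
  {x | x ≤ coord F n (mIdx n) ∨ coord F n (mIdx n) ≤ x ∨
    (∃ i, coord F n (pIdx n i) ≤ x ∧ x ≤ coord F n (rIdx n i)) ∨
    (∃ i, coord F n (qIdx n i) ≤ x ∧ x ≤ coord F n (sIdx n i))}

/-- The linear map multiplying the coordinate of `β_0` by `a` and fixing all other coordinates. -/
def scale (F : Type*) [Field F] (n : ℕ) (a : Fˣ) : Space F n →ₗ[F] Space F n where
  toFun v k := if k = Sum.inr 0 then (a : F) * v k else v k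
  map_add' v w := by
    funext k
    by_cases hk : k = Sum.inr 0 <;> simp [hk, mul_add]
  map_smul' c v := by
    funext k
    by_cases hk : k = Sum.inr 0 <;> simp [hk, mul_left_comm]

open Classical in
/-- The regluing map: apply `scale` to the subspaces of `s_0` and leave all others unchanged. -/
noncomputable def twist (F : Type*) [Field F] (n : ℕ) (a : Fˣ) (x : Submodule F (Space F n)) :
    Submodule F (Space F n) :=
  if x ≤ coord F n (sIdx n 0) then x.map (scale F n a) else x

open Classical in
/-- The image of a subspace in `[m, 1]`: the subspace itself if it contains `m`, and
`twist (x + m)` otherwise. -/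
noncomputable def glue (F : Type*) [Field F] (n : ℕ) (a : Fˣ) (x : Submodule F (Space F n)) :
    Submodule F (Space F n) :=
  if coord F n (mIdx n) ≤ x then x else twist F n a (x ⊔ coord F n (mIdx n))

/-! ### Closure of the union of the intervals under joins and meets -/

theorem coord_mono (F : Type*) [Field F] (n : ℕ) {I J : Set (ZMod n ⊕ ZMod n)} (h : I ⊆ J) :
    coord F n I ≤ coord F n J :=
  fun _ hv k hk => hv k (fun h' => hk (h h'))

theorem coord_union_le (F : Type*) [Field F] (n : ℕ) (I J : Set (ZMod n ⊕ ZMod n)) :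
    coord F n (I ∪ J) ≤ coord F n I ⊔ coord F n J := by
  classical
  intro v hv
  rw [Submodule.mem_sup]
  refine ⟨fun k => if k ∈ I then v k else 0, fun k hk => by simp [hk],
    fun k => if k ∈ I then 0 else v k, fun k hk => ?_, ?_⟩
  · by_cases hI : k ∈ I
    · simp [hI]
    · simpa [hI] using hv k (by simp [hI, hk])
  · funext k
    by_cases hI : k ∈ I <;> simp [hI]

theorem inf_le_coord_inter (F : Type*) [Field F] (n : ℕ) (I J : Set (ZMod n ⊕ ZMod n)) :
    coord F n I ⊓ coord F n J ≤ coord F n (I ∩ J) := by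
  rintro v ⟨hI, hJ⟩ k hk
  by_cases h : k ∈ I
  · exact hJ k (fun h' => hk ⟨h, h'⟩)
  · exact hI k h

/-- The pairs of index sets of the end points of the intervals. -/
def IsBlock (n : ℕ) (I J : Set (ZMod n ⊕ ZMod n)) : Prop :=
  (I = ∅ ∧ J = mIdx n) ∨ (I = mIdx n ∧ J = Set.univ) ∨
    (∃ i, I = pIdx n i ∧ J = rIdx n i) ∨ (∃ i, I = qIdx n i ∧ J = sIdx n i)

theorem mem_blocks_iff (F : Type*) [Field F] (n : ℕ) (x : Submodule F (Space F n)) :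
    x ∈ blocks F n ↔ ∃ I J, IsBlock n I J ∧ coord F n I ≤ x ∧ x ≤ coord F n J := by
  constructor
  · rintro (h | h | ⟨i, h⟩ | ⟨i, h⟩)
    · refine ⟨∅, mIdx n, Or.inl ⟨rfl, rfl⟩, fun v hv => ?_, h⟩
      have : v = 0 := funext fun k => hv k (by simp)
      simp [this]
    · exact ⟨_, _, Or.inr (Or.inl ⟨rfl, rfl⟩), h, fun v _ k hk => absurd (Set.mem_univ k) hk⟩
    · exact ⟨_, _, Or.inr (Or.inr (Or.inl ⟨i, rfl, rfl⟩)), h⟩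
    · exact ⟨_, _, Or.inr (Or.inr (Or.inr ⟨i, rfl, rfl⟩)), h⟩
  · rintro ⟨I, J, (⟨rfl, rfl⟩ | ⟨rfl, rfl⟩ | ⟨i, rfl, rfl⟩ | ⟨i, rfl, rfl⟩), h⟩
    · exact Or.inl h.2
    · exact Or.inr (Or.inl h.1)
    · exact Or.inr (Or.inr (Or.inl ⟨i, h⟩))
    · exact Or.inr (Or.inr (Or.inr ⟨i, h⟩))

theorem one_ne_zero_zmod (n : ℕ) [hn : Fact (3 ≤ n)] : (1 : ZMod n) ≠ 0 := by
  intro h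
  have h1 : ((1 : ℕ) : ZMod n) = 0 := by simpa using h
  rw [ZMod.natCast_eq_zero_iff] at h1
  have := Nat.le_of_dvd one_pos h1
  have := hn.out
  omega

theorem two_ne_zero_zmod (n : ℕ) [hn : Fact (3 ≤ n)] : (1 + 1 : ZMod n) ≠ 0 := by
  intro h
  have h1 : ((2 : ℕ) : ZMod n) = 0 := by
    rw [Nat.cast_ofNat, ← one_add_one_eq_two]
    exact h
  rw [ZMod.natCast_eq_zero_iff] at h1
  have := Nat.le_of_dvd two_pos h1
  have := hn.out
  omega

theorem IsBlock.lo_subset {n : ℕ} {I J : Set (ZMod n ⊕ ZMod n)} (h : IsBlock n I J) :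
    I ⊆ mIdx n := by
  rcases h with ⟨rfl, rfl⟩ | ⟨rfl, rfl⟩ | ⟨i, rfl, rfl⟩ | ⟨i, rfl, rfl⟩
  · exact Set.empty_subset _
  · exact subset_rfl
  · exact Set.image_subset_range _ _
  · exact Set.image_subset_range _ _

theorem IsBlock.subset_hi {n : ℕ} {I J : Set (ZMod n ⊕ ZMod n)} (h : IsBlock n I J) :
    mIdx n ⊆ J := by
  rcases h with ⟨rfl, rfl⟩ | ⟨rfl, rfl⟩ | ⟨i, rfl, rfl⟩ | ⟨i, rfl, rfl⟩
  · exact subset_rfl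
  · exact Set.subset_univ _
  · exact Set.subset_union_left
  · exact Set.subset_union_left

theorem isBlock_sup (n : ℕ) [Fact (3 ≤ n)] {I J I' J' : Set (ZMod n ⊕ ZMod n)}
    (h : IsBlock n I J) (h' : IsBlock n I' J') :
    ∃ K L, IsBlock n K L ∧ K ⊆ I ∪ I' ∧ J ∪ J' ⊆ L := by
  have h1 := one_ne_zero_zmod n
  have h2 := two_ne_zero_zmod n
  have top : mIdx n ⊆ I ∪ I' → ∃ K L, IsBlock n K L ∧ K ⊆ I ∪ I' ∧ J ∪ J' ⊆ L := fun hm =>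
    ⟨mIdx n, Set.univ, Or.inr (Or.inl ⟨rfl, rfl⟩), hm, Set.subset_univ _⟩
  have hs := h.subset_hi
  have hs' := h'.subset_hi
  have hb := h
  have hb' := h'
  rcases h with ⟨rfl, rfl⟩ | ⟨rfl, rfl⟩ | ⟨i, rfl, rfl⟩ | ⟨i, rfl, rfl⟩
  · exact ⟨_, _, hb', Set.subset_union_right, Set.union_subset hs' subset_rfl⟩
  · exact top Set.subset_union_left
  all_goals rcases h' with ⟨rfl, rfl⟩ | ⟨rfl, rfl⟩ | ⟨j, rfl, rfl⟩ | ⟨j, rfl, rfl⟩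
  · exact ⟨_, _, hb, Set.subset_union_left, Set.union_subset subset_rfl hs⟩
  · exact top Set.subset_union_right
  · by_cases hij : i = j
    · subst hij
      exact ⟨_, _, hb, Set.subset_union_left, Set.union_subset subset_rfl subset_rfl⟩
    by_cases hij1 : j = i + 1
    · refine ⟨qIdx n j, sIdx n j, Or.inr (Or.inr (Or.inr ⟨j, rfl, rfl⟩)), ?_, ?_⟩
      · rintro (k | k) <;> simp [qIdx, pIdx] <;> grind
      · rintro (k | k) <;> simp [sIdx, rIdx, mIdx] <;> grind
    by_cases hij2 : i = j + 1
    · refine ⟨qIdx n i, sIdx n i, Or.inr (Or.inr (Or.inr ⟨i, rfl, rfl⟩)), ?_, ?_⟩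
      · rintro (k | k) <;> simp [qIdx, pIdx] <;> grind
      · rintro (k | k) <;> simp [sIdx, rIdx, mIdx] <;> grind
    refine top ?_
    rintro (k | k) <;> simp [mIdx, pIdx] <;> grind
  · by_cases hij : i = j ∨ i + 1 = j
    · refine ⟨_, _, hb', Set.subset_union_right, ?_⟩
      rintro (k | k) <;> simp [sIdx, rIdx, mIdx] <;> grind
    refine top ?_
    rintro (k | k) <;> simp [mIdx, pIdx, qIdx] <;> grind
  · exact ⟨_, _, hb, Set.subset_union_left, Set.union_subset subset_rfl hs⟩
  · exact top Set.subset_union_right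
  · by_cases hij : j = i ∨ j + 1 = i
    · refine ⟨_, _, hb, Set.subset_union_left, ?_⟩
      rintro (k | k) <;> simp [sIdx, rIdx, mIdx] <;> grind
    refine top ?_
    rintro (k | k) <;> simp [mIdx, pIdx, qIdx] <;> grind
  · by_cases hij : i = j
    · subst hij
      exact ⟨_, _, hb, Set.subset_union_left, Set.union_subset subset_rfl subset_rfl⟩
    refine top ?_
    rintro (k | k) <;> simp [mIdx, qIdx] <;> grind

theorem isBlock_inf (n : ℕ) [Fact (3 ≤ n)] {I J I' J' : Set (ZMod n ⊕ ZMod n)}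
    (h : IsBlock n I J) (h' : IsBlock n I' J') :
    ∃ K L, IsBlock n K L ∧ K ⊆ I ∧ K ⊆ I' ∧ J ∩ J' ⊆ L := by
  have h1 := one_ne_zero_zmod n
  have h2 := two_ne_zero_zmod n
  have bot : J ∩ J' ⊆ mIdx n → ∃ K L, IsBlock n K L ∧ K ⊆ I ∧ K ⊆ I' ∧ J ∩ J' ⊆ L := fun hm =>
    ⟨∅, mIdx n, Or.inl ⟨rfl, rfl⟩, Set.empty_subset _, Set.empty_subset _, hm⟩
  have hs := h.lo_subset
  have hs' := h'.lo_subset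
  have hb := h
  have hb' := h'
  rcases h with ⟨rfl, rfl⟩ | ⟨rfl, rfl⟩ | ⟨i, rfl, rfl⟩ | ⟨i, rfl, rfl⟩
  · exact bot Set.inter_subset_left
  · exact ⟨_, _, hb', hs', subset_rfl, Set.inter_subset_right⟩
  all_goals rcases h' with ⟨rfl, rfl⟩ | ⟨rfl, rfl⟩ | ⟨j, rfl, rfl⟩ | ⟨j, rfl, rfl⟩
  · exact bot Set.inter_subset_right
  · exact ⟨_, _, hb, subset_rfl, hs, Set.inter_subset_left⟩
  · by_cases hij : i = j
    · subst hij
      exact ⟨_, _, hb, subset_rfl, subset_rfl, Set.inter_subset_left⟩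
    refine bot ?_
    rintro (k | k) <;> simp [rIdx, mIdx] <;> grind
  · by_cases hij : i = j ∨ i + 1 = j
    · refine ⟨_, _, hb, subset_rfl, ?_, Set.inter_subset_left⟩
      rintro (k | k) <;> simp [qIdx, pIdx] <;> grind
    refine bot ?_
    rintro (k | k) <;> simp [rIdx, sIdx, mIdx] <;> grind
  · exact bot Set.inter_subset_right
  · exact ⟨_, _, hb, subset_rfl, hs, Set.inter_subset_left⟩
  · by_cases hij : j = i ∨ j + 1 = i
    · refine ⟨_, _, hb', ?_, subset_rfl, Set.inter_subset_right⟩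
      rintro (k | k) <;> simp [qIdx, pIdx] <;> grind
    refine bot ?_
    rintro (k | k) <;> simp [rIdx, sIdx, mIdx] <;> grind
  · by_cases hij : i = j
    · subst hij
      exact ⟨_, _, hb, subset_rfl, subset_rfl, Set.inter_subset_left⟩
    by_cases hij1 : j = i + 1
    · refine ⟨pIdx n i, rIdx n i, Or.inr (Or.inr (Or.inl ⟨i, rfl, rfl⟩)), ?_, ?_, ?_⟩
      · rintro (k | k) <;> simp [qIdx, pIdx] <;> grind
      · rintro (k | k) <;> simp [qIdx, pIdx] <;> grind
      · rintro (k | k) <;> simp [sIdx, rIdx, mIdx] <;> grind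
    by_cases hij2 : i = j + 1
    · refine ⟨pIdx n j, rIdx n j, Or.inr (Or.inr (Or.inl ⟨j, rfl, rfl⟩)), ?_, ?_, ?_⟩
      · rintro (k | k) <;> simp [qIdx, pIdx] <;> grind
      · rintro (k | k) <;> simp [qIdx, pIdx] <;> grind
      · rintro (k | k) <;> simp [sIdx, rIdx, mIdx] <;> grind
    refine bot ?_
    rintro (k | k) <;> simp [sIdx, mIdx] <;> grind

theorem sup_mem_blocks (F : Type*) [Field F] (n : ℕ) [Fact (3 ≤ n)]
    {x y : Submodule F (Space F n)} (hx : x ∈ blocks F n) (hy : y ∈ blocks F n) :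
    x ⊔ y ∈ blocks F n := by
  rw [mem_blocks_iff] at hx hy ⊢
  obtain ⟨I, J, hb, hI, hJ⟩ := hx
  obtain ⟨I', J', hb', hI', hJ'⟩ := hy
  obtain ⟨K, L, hKL, hK, hL⟩ := isBlock_sup n hb hb'
  refine ⟨K, L, hKL, ?_, ?_⟩
  · exact (coord_mono F n hK).trans ((coord_union_le F n I I').trans (sup_le_sup hI hI'))
  · exact sup_le (hJ.trans (coord_mono F n (Set.subset_union_left.trans hL)))
      (hJ'.trans (coord_mono F n (Set.subset_union_right.trans hL)))

theorem inf_mem_blocks (F : Type*) [Field F] (n : ℕ) [Fact (3 ≤ n)]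
    {x y : Submodule F (Space F n)} (hx : x ∈ blocks F n) (hy : y ∈ blocks F n) :
    x ⊓ y ∈ blocks F n := by
  rw [mem_blocks_iff] at hx hy ⊢
  obtain ⟨I, J, hb, hI, hJ⟩ := hx
  obtain ⟨I', J', hb', hI', hJ'⟩ := hy
  obtain ⟨K, L, hKL, hK, hK', hL⟩ := isBlock_inf n hb hb'
  refine ⟨K, L, hKL, ?_, ?_⟩
  · exact le_inf ((coord_mono F n hK).trans hI) ((coord_mono F n hK').trans hI')
  · exact (inf_le_inf hJ hJ').trans ((inf_le_coord_inter F n J J').trans (coord_mono F n hL))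

/-! ### Properties of the regluing map -/

theorem scale_scale (F : Type*) [Field F] (n : ℕ) (a b : Fˣ) (hab : a * b = 1) :
    (scale F n a).comp (scale F n b) = LinearMap.id := by
  have h : (a : F) * (b : F) = 1 := by rw [← Units.val_mul, hab, Units.val_one]
  ext v k
  by_cases hk : k = Sum.inr 0 <;> simp [scale, hk, ← mul_assoc, h]

theorem map_scale_coord_le (F : Type*) [Field F] (n : ℕ) (a : Fˣ) {x : Submodule F (Space F n)}
    {I : Set (ZMod n ⊕ ZMod n)} (h : x ≤ coord F n I) : x.map (scale F n a) ≤ coord F n I := by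
  rintro _ ⟨v, hv, rfl⟩ k hk
  have := h hv k hk
  by_cases h0 : k = Sum.inr 0 <;> simp_all [scale]

theorem map_scale_cancel (F : Type*) [Field F] (n : ℕ) (a b : Fˣ) (hab : a * b = 1)
    (x : Submodule F (Space F n)) : (x.map (scale F n b)).map (scale F n a) = x := by
  rw [← Submodule.map_comp, scale_scale F n a b hab, Submodule.map_id]

theorem twist_twist (F : Type*) [Field F] (n : ℕ) (a b : Fˣ) (hab : a * b = 1)
    (x : Submodule F (Space F n)) : twist F n a (twist F n b x) = x := by
  by_cases h : x ≤ coord F n (sIdx n 0)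
  · have h' := map_scale_coord_le F n b h
    rw [show twist F n b x = x.map (scale F n b) from if_pos h, twist, if_pos h',
      map_scale_cancel F n a b hab]
  · rw [show twist F n b x = x from if_neg h, twist, if_neg h]

/-- The subspaces containing `m` and contained in some `s_i`. -/
def collar (F : Type*) [Field F] (n : ℕ) : Set (Submodule F (Space F n)) :=
  {x | coord F n (mIdx n) ≤ x ∧ ∃ i, x ≤ coord F n (sIdx n i)}

theorem map_scale_le_self (F : Type*) [Field F] (n : ℕ) (a : Fˣ) {x : Submodule F (Space F n)}
    (k : ZMod n) (hm : coord F n (mIdx n) ≤ x) (hk : x ≤ coord F n (rIdx n k)) :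
    x.map (scale F n a) ≤ x := by
  rintro _ ⟨v, hv, rfl⟩
  have key : scale F n a v - (if k = 0 then (a : F) else 1) • v ∈ coord F n (mIdx n) := by
    rintro (j | j) hj
    · exact absurd ⟨j, rfl⟩ hj
    · by_cases hjk : j = k
      · subst hjk
        by_cases h0 : j = 0 <;> simp [scale, h0]
      · have hv0 : v (Sum.inr j) = 0 := hk hv _ (by simp [rIdx, mIdx, hjk])
        by_cases h0 : k = 0 <;> simp [scale, hv0, h0]
  have := x.add_mem (hm key) (x.smul_mem (if k = 0 then (a : F) else 1) hv)
  simpa using this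

theorem sIdx_inter (n : ℕ) [Fact (3 ≤ n)] {i : ZMod n} (hi : i ≠ 0) :
    ∃ k, sIdx n 0 ∩ sIdx n i ⊆ rIdx n k := by
  have h1 := one_ne_zero_zmod n
  have h2 := two_ne_zero_zmod n
  by_cases h : i = 1
  · refine ⟨0, ?_⟩
    rintro (k | k) <;> simp [sIdx, rIdx, mIdx] <;> grind
  · refine ⟨-1, ?_⟩
    rintro (k | k) <;> simp [sIdx, rIdx, mIdx] <;> grind

theorem twist_mono (F : Type*) [Field F] (n : ℕ) [Fact (3 ≤ n)] (a : Fˣ)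
    {x y : Submodule F (Space F n)} (hx : coord F n (mIdx n) ≤ x) (hy : y ∈ collar F n)
    (hxy : x ≤ y) : twist F n a x ≤ twist F n a y := by
  by_cases h : y ≤ coord F n (sIdx n 0)
  · simp only [twist, if_pos h, if_pos (hxy.trans h)]
    exact Submodule.map_mono hxy
  · by_cases h' : x ≤ coord F n (sIdx n 0)
    · simp only [twist, if_pos h', if_neg h]
      obtain ⟨-, i, hi⟩ := hy
      have hi0 : i ≠ 0 := by
        rintro rfl
        exact h hi
      obtain ⟨k, hk⟩ := sIdx_inter n hi0
      refine (map_scale_le_self F n a k hx ?_).trans hxy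
      exact (le_inf h' (hxy.trans hi)).trans
        ((inf_le_coord_inter F n _ _).trans (coord_mono F n hk))
    · simpa only [twist, if_neg h, if_neg h'] using hxy

theorem le_twist (F : Type*) [Field F] (n : ℕ) (a : Fˣ) {x : Submodule F (Space F n)}
    (hx : coord F n (mIdx n) ≤ x) : coord F n (mIdx n) ≤ twist F n a x := by
  by_cases h : x ≤ coord F n (sIdx n 0)
  · simp only [twist, if_pos h]
    intro v hv
    refine ⟨v, hx hv, ?_⟩
    funext k
    by_cases hk : k = Sum.inr 0
    · have : v k = 0 := hv k (by simp [hk, mIdx])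
      simp [scale, this]
    · simp [scale, hk]
  · simpa only [twist, if_neg h] using hx

theorem twist_mem_collar (F : Type*) [Field F] (n : ℕ) (a : Fˣ) {x : Submodule F (Space F n)}
    (hx : x ∈ collar F n) : twist F n a x ∈ collar F n := by
  refine ⟨le_twist F n a hx.1, ?_⟩
  by_cases h : x ≤ coord F n (sIdx n 0)
  · exact ⟨0, by simpa only [twist, if_pos h] using map_scale_coord_le F n a h⟩
  · simpa only [twist, if_neg h] using hx.2

theorem sup_mem_collar (F : Type*) [Field F] (n : ℕ) {x : Submodule F (Space F n)}
    (hx : x ∈ blocks F n) (hm : ¬ coord F n (mIdx n) ≤ x) :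
    x ⊔ coord F n (mIdx n) ∈ collar F n := by
  refine ⟨le_sup_right, ?_⟩
  have hs : ∀ i, coord F n (mIdx n) ≤ coord F n (sIdx n i) := fun i =>
    coord_mono F n Set.subset_union_left
  rcases hx with h | h | ⟨i, -, h⟩ | ⟨i, -, h⟩
  · exact ⟨0, sup_le (h.trans (hs 0)) (hs 0)⟩
  · exact absurd h hm
  · refine ⟨i, sup_le (h.trans (coord_mono F n ?_)) (hs i)⟩
    exact Set.union_subset_union_right _ (by simp)
  · exact ⟨i, sup_le h (hs i)⟩

theorem collar_lower (F : Type*) [Field F] (n : ℕ) {x y : Submodule F (Space F n)}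
    (hy : y ∈ collar F n) (hx : coord F n (mIdx n) ≤ x) (hxy : x ≤ y) : x ∈ collar F n :=
  ⟨hx, hy.2.imp fun _ hi => hxy.trans hi⟩

theorem le_glue (F : Type*) [Field F] (n : ℕ) (a : Fˣ) (x : Submodule F (Space F n)) :
    coord F n (mIdx n) ≤ glue F n a x := by
  by_cases h : coord F n (mIdx n) ≤ x
  · simpa only [glue, if_pos h] using h
  · simpa only [glue, if_neg h] using le_twist F n a le_sup_right

/-- The meet in Haiman's lattice of a subspace `x` not above `m` and a subspace `y` above `m`. -/
noncomputable def crossInf (F : Type*) [Field F] (n : ℕ) (a : Fˣ)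
    (x y : Submodule F (Space F n)) : Submodule F (Space F n) :=
  x ⊓ twist F n a⁻¹ (y ⊓ twist F n a (x ⊔ coord F n (mIdx n)))

theorem crossInf_aux (F : Type*) [Field F] (n : ℕ) (a : Fˣ)
    {x y : Submodule F (Space F n)} (hx : x ∈ blocks F n) (hm : ¬ coord F n (mIdx n) ≤ x)
    (hy : coord F n (mIdx n) ≤ y) :
    y ⊓ twist F n a (x ⊔ coord F n (mIdx n)) ∈ collar F n :=
  have h := twist_mem_collar F n a (sup_mem_collar F n hx hm)
  collar_lower F n h (le_inf hy h.1) inf_le_right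

theorem crossInf_mem_blocks (F : Type*) [Field F] (n : ℕ) [Fact (3 ≤ n)] (a : Fˣ)
    {x y : Submodule F (Space F n)} (hx : x ∈ blocks F n) (hm : ¬ coord F n (mIdx n) ≤ x)
    (hy : coord F n (mIdx n) ≤ y) : crossInf F n a x y ∈ blocks F n :=
  inf_mem_blocks F n hx
    (Or.inr (Or.inl (twist_mem_collar F n a⁻¹ (crossInf_aux F n a hx hm hy)).1))

theorem glue_crossInf_le (F : Type*) [Field F] (n : ℕ) [Fact (3 ≤ n)] (a : Fˣ)
    {x y : Submodule F (Space F n)} (hx : x ∈ blocks F n) (hm : ¬ coord F n (mIdx n) ≤ x)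
    (hy : coord F n (mIdx n) ≤ y) : glue F n a (crossInf F n a x y) ≤ y := by
  have hw : ¬ coord F n (mIdx n) ≤ crossInf F n a x y := fun h => hm (h.trans inf_le_left)
  have hc := twist_mem_collar F n a⁻¹ (crossInf_aux F n a hx hm hy)
  have h1 := twist_mono F n a (x := crossInf F n a x y ⊔ coord F n (mIdx n)) le_sup_right hc
    (sup_le inf_le_right hc.1)
  rw [twist_twist F n a a⁻¹ (mul_inv_cancel a)] at h1
  simpa only [glue, if_neg hw] using h1.trans inf_le_left

theorem le_crossInf (F : Type*) [Field F] (n : ℕ) [Fact (3 ≤ n)] (a : Fˣ)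
    {x y z : Submodule F (Space F n)} (hx : x ∈ blocks F n) (hm : ¬ coord F n (mIdx n) ≤ x)
    (hy : coord F n (mIdx n) ≤ y) (hzx : z ≤ x) (hzy : glue F n a z ≤ y) :
    z ≤ crossInf F n a x y := by
  have hz : ¬ coord F n (mIdx n) ≤ z := fun h => hm (h.trans hzx)
  simp only [glue, if_neg hz] at hzy
  have hc := crossInf_aux F n a hx hm hy
  have h1 := twist_mono F n a (x := z ⊔ coord F n (mIdx n)) le_sup_right
    (sup_mem_collar F n hx hm) (sup_le_sup_right hzx _)
  have h2 := twist_mono F n a⁻¹ (le_twist F n a le_sup_right) hc (le_inf hzy h1)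
  rw [twist_twist F n a⁻¹ a (inv_mul_cancel a)] at h2
  exact le_inf hzx (le_sup_left.trans h2)

theorem glue_mono (F : Type*) [Field F] (n : ℕ) [Fact (3 ≤ n)] (a : Fˣ)
    {x y : Submodule F (Space F n)} (hy : y ∈ blocks F n) (hm : ¬ coord F n (mIdx n) ≤ y)
    (hxy : x ≤ y) : glue F n a x ≤ glue F n a y := by
  have hx : ¬ coord F n (mIdx n) ≤ x := fun h => hm (h.trans hxy)
  simp only [glue, if_neg hx, if_neg hm]
  exact twist_mono F n a le_sup_right (sup_mem_collar F n hy hm) (sup_le_sup_right hxy _)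

theorem glue_sup_le (F : Type*) [Field F] (n : ℕ) [Fact (3 ≤ n)] (a : Fˣ)
    {x y z : Submodule F (Space F n)} (hxy : x ⊔ y ∈ blocks F n)
    (hm : ¬ coord F n (mIdx n) ≤ x ⊔ y) (hz : coord F n (mIdx n) ≤ z)
    (hxz : glue F n a x ≤ z) (hyz : glue F n a y ≤ z) : glue F n a (x ⊔ y) ≤ z := by
  have h1 := le_crossInf F n a hxy hm hz le_sup_left hxz
  have h2 := le_crossInf F n a hxy hm hz le_sup_right hyz
  have h3 : crossInf F n a (x ⊔ y) z = x ⊔ y := le_antisymm inf_le_left (sup_le h1 h2)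
  exact h3 ▸ glue_crossInf_le F n a hxy hm hz

end Haiman

/-- (The elements of) Haiman's lattice `H_n(F)` with twisting parameter `a`: the subspaces of
`F ^ (2n)` in one of the intervals `[0, m]`, `[m, 1]`, `[p_i, r_i]`, `[q_i, s_i]`. -/
@[ext]
structure HaimanLattice (F : Type*) [Field F] (n : ℕ) (a : Fˣ) where
  toSubmodule : Submodule F (Haiman.Space F n)
  mem_blocks : toSubmodule ∈ Haiman.blocks F n

namespace HaimanLattice

open Classical in
/-- The order of Haiman's lattice. It is inclusion, except that `[m, 1]` is glued to `[q_0, s_0]`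
by means of the twist: if `y` contains `m` and `x` does not, then `x` is below `y` if and only if
`twist (x + m) ⊆ y`. -/
instance instLE (F : Type*) [Field F] (n : ℕ) (a : Fˣ) : LE (HaimanLattice F n a) where
  le x y :=
    if Haiman.coord F n (Haiman.mIdx n) ≤ y.toSubmodule then
      Haiman.glue F n a x.toSubmodule ≤ y.toSubmodule
    else x.toSubmodule ≤ y.toSubmodule

theorem le_iff_of_le {F : Type*} [Field F] {n : ℕ} {a : Fˣ} {x y : HaimanLattice F n a}
    (h : Haiman.coord F n (Haiman.mIdx n) ≤ y.toSubmodule) :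
    x ≤ y ↔ Haiman.glue F n a x.toSubmodule ≤ y.toSubmodule :=
  iff_of_eq (if_pos h)

theorem le_iff_of_not_le {F : Type*} [Field F] {n : ℕ} {a : Fˣ} {x y : HaimanLattice F n a}
    (h : ¬ Haiman.coord F n (Haiman.mIdx n) ≤ y.toSubmodule) :
    x ≤ y ↔ x.toSubmodule ≤ y.toSubmodule :=
  iff_of_eq (if_neg h)

instance instPartialOrder (F : Type*) [Field F] (n : ℕ) [Fact (3 ≤ n)] (a : Fˣ) :
    PartialOrder (HaimanLattice F n a) where
  le_refl x := by
    by_cases h : Haiman.coord F n (Haiman.mIdx n) ≤ x.toSubmodule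
    · rw [le_iff_of_le h, Haiman.glue, if_pos h]
    · rw [le_iff_of_not_le h]
  le_trans x y z hxy hyz := by
    by_cases hz : Haiman.coord F n (Haiman.mIdx n) ≤ z.toSubmodule
    · rw [le_iff_of_le hz] at hyz ⊢
      by_cases hy : Haiman.coord F n (Haiman.mIdx n) ≤ y.toSubmodule
      · rw [le_iff_of_le hy] at hxy
        rw [Haiman.glue, if_pos hy] at hyz
        exact hxy.trans hyz
      · rw [le_iff_of_not_le hy] at hxy
        exact (Haiman.glue_mono F n a y.mem_blocks hy hxy).trans hyz
    · rw [le_iff_of_not_le hz] at hyz ⊢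
      have hy : ¬ Haiman.coord F n (Haiman.mIdx n) ≤ y.toSubmodule := fun h => hz (h.trans hyz)
      rw [le_iff_of_not_le hy] at hxy
      exact hxy.trans hyz
  le_antisymm x y hxy hyx := by
    have key : ∀ x y : HaimanLattice F n a, x ≤ y → y ≤ x →
        Haiman.coord F n (Haiman.mIdx n) ≤ x.toSubmodule → x.toSubmodule ≤ y.toSubmodule := by
      intro x y hxy hyx hx
      by_cases hy : Haiman.coord F n (Haiman.mIdx n) ≤ y.toSubmodule
      · rwa [le_iff_of_le hy, Haiman.glue, if_pos hx] at hxy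
      · rwa [le_iff_of_not_le hy] at hxy
    by_cases hx : Haiman.coord F n (Haiman.mIdx n) ≤ x.toSubmodule
    · have h := key x y hxy hyx hx
      exact HaimanLattice.ext (le_antisymm h (key y x hyx hxy (hx.trans h)))
    · by_cases hy : Haiman.coord F n (Haiman.mIdx n) ≤ y.toSubmodule
      · exact absurd (hy.trans (key y x hyx hxy hy)) hx
      · rw [le_iff_of_not_le hy] at hxy
        rw [le_iff_of_not_le hx] at hyx
        exact HaimanLattice.ext (le_antisymm hxy hyx)

open Classical in
/-- Haiman's lattice is a lattice. -/
noncomputable instance instLattice (F : Type*) [Field F] (n : ℕ) [Fact (3 ≤ n)] (a : Fˣ) :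
    Lattice (HaimanLattice F n a) where
  sup x y :=
    if h : Haiman.coord F n (Haiman.mIdx n) ≤ x.toSubmodule ⊔ y.toSubmodule then
      ⟨Haiman.glue F n a x.toSubmodule ⊔ Haiman.glue F n a y.toSubmodule,
        Or.inr (Or.inl ((Haiman.le_glue F n a _).trans le_sup_left))⟩
    else ⟨x.toSubmodule ⊔ y.toSubmodule, Haiman.sup_mem_blocks F n x.mem_blocks y.mem_blocks⟩
  inf x y :=
    if hx : Haiman.coord F n (Haiman.mIdx n) ≤ x.toSubmodule then
      if hy : Haiman.coord F n (Haiman.mIdx n) ≤ y.toSubmodule then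
        ⟨x.toSubmodule ⊓ y.toSubmodule, Haiman.inf_mem_blocks F n x.mem_blocks y.mem_blocks⟩
      else ⟨Haiman.crossInf F n a y.toSubmodule x.toSubmodule,
        Haiman.crossInf_mem_blocks F n a y.mem_blocks hy hx⟩
    else
      if hy : Haiman.coord F n (Haiman.mIdx n) ≤ y.toSubmodule then
        ⟨Haiman.crossInf F n a x.toSubmodule y.toSubmodule,
          Haiman.crossInf_mem_blocks F n a x.mem_blocks hx hy⟩
      else ⟨x.toSubmodule ⊓ y.toSubmodule, Haiman.inf_mem_blocks F n x.mem_blocks y.mem_blocks⟩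
  le_sup_left x y := by
    split_ifs with h
    · exact (le_iff_of_le ((Haiman.le_glue F n a _).trans le_sup_left)).2 le_sup_left
    · exact (le_iff_of_not_le h).2 le_sup_left
  le_sup_right x y := by
    split_ifs with h
    · exact (le_iff_of_le ((Haiman.le_glue F n a _).trans le_sup_left)).2 le_sup_right
    · exact (le_iff_of_not_le h).2 le_sup_right
  sup_le x y z hxz hyz := by
    by_cases hz : Haiman.coord F n (Haiman.mIdx n) ≤ z.toSubmodule
    · rw [le_iff_of_le hz] at hxz hyz
      split_ifs with h
      · rw [le_iff_of_le hz, Haiman.glue, if_pos ((Haiman.le_glue F n a _).trans le_sup_left)]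
        exact sup_le hxz hyz
      · rw [le_iff_of_le hz]
        exact Haiman.glue_sup_le F n a (Haiman.sup_mem_blocks F n x.mem_blocks y.mem_blocks) h hz
          hxz hyz
    · rw [le_iff_of_not_le hz] at hxz hyz
      rw [dif_neg (fun h => hz (h.trans (sup_le hxz hyz))), le_iff_of_not_le hz]
      exact sup_le hxz hyz
  inf_le_left x y := by
    split_ifs with hx hy hy
    · rw [le_iff_of_le hx, Haiman.glue, if_pos (le_inf hx hy)]
      exact inf_le_left
    · exact (le_iff_of_le hx).2 (Haiman.glue_crossInf_le F n a y.mem_blocks hy hx)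
    · exact (le_iff_of_not_le hx).2 inf_le_left
    · exact (le_iff_of_not_le hx).2 inf_le_left
  inf_le_right x y := by
    split_ifs with hx hy hy
    · rw [le_iff_of_le hy, Haiman.glue, if_pos (le_inf hx hy)]
      exact inf_le_right
    · exact (le_iff_of_not_le hy).2 inf_le_left
    · exact (le_iff_of_le hy).2 (Haiman.glue_crossInf_le F n a x.mem_blocks hx hy)
    · exact (le_iff_of_not_le hy).2 inf_le_right
  le_inf x y z hxy hxz := by
    split_ifs with hy hz hz
    · rw [le_iff_of_le hy] at hxy
      rw [le_iff_of_le hz] at hxz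
      exact (le_iff_of_le (le_inf hy hz)).2 (le_inf hxy hxz)
    · rw [le_iff_of_le hy] at hxy
      rw [le_iff_of_not_le hz] at hxz
      exact (le_iff_of_not_le (fun h => hz (h.trans inf_le_left))).2
        (Haiman.le_crossInf F n a z.mem_blocks hz hy hxz hxy)
    · rw [le_iff_of_not_le hy] at hxy
      rw [le_iff_of_le hz] at hxz
      exact (le_iff_of_not_le (fun h => hy (h.trans inf_le_left))).2
        (Haiman.le_crossInf F n a y.mem_blocks hy hz hxy hxz)
    · rw [le_iff_of_not_le hy] at hxy
      rw [le_iff_of_not_le hz] at hxz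
      exact (le_iff_of_not_le (fun h => hy (h.trans inf_le_left))).2 (le_inf hxy hxz)

end HaimanLattice

/-! The weak difference term enters through a single consequence. Suppose that congruences `α`, `β`,
`γ` have the same pairwise meet `δ`, with `α ≤ β ⊔ γ` and `β ≤ α ⊔ γ`. The centrality `C(α, β; α ⊓
β)` always holds, and for fixed second and third argument the centralizing congruences are closed
under joins. Hence `[α, α] ≤ δ` and `[β, β] ≤ δ` (`algCommutator_self_le`). The weak difference term
then makes `α` and `β` permute, so `α ⊔ β` is their composition
(`IsWeakDifferenceTerm.exists_of_sup_rel`). In both families of lattices such triples are three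
collinear points of some interval. A pair related by an element below the join of two of them
therefore acquires an interpolating element of the algebra, and these elements are used as in a
coordinate argument.

Planes: a pair `(s, t)` in the congruence of the centre `o` is interpolated on each line `l i` by
some `r i`, via `a i` and `b i`. The pair `(r j, r k)` then lies in the congruence of `g i ⊓ h i`,
that is, of `c i`. If the `c i` were not collinear, composing two of these relations and meeting
with the third would identify `r 0` and `r 1` modulo the empty subspace, and then also `s` and `t`.
So `o` would have the same image as the empty subspace.

Haiman's lattices: `xElt i`, `yElt i`, `tElt i` are collinear points of `[p_i, r_i]`, and the
diagonal `⟨∑ α_j⟩` lies below each `xElt i ⊔ yElt i`. A pair `(p, r)` in the congruence of the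
diagonal yields elements `z i`, which play the role of the vectors `β_i`. Consecutive ones are
related by `cElt i`, that is, by `q_i + ⟨β_i - β_{i-1}⟩`. For `i ≠ 0` this lies in the hyperplane
`sumZero`, so going round the cycle relates `z 0` and `z (-1)` modulo `sumZero`. The remaining
relation `cElt 0` is moved by the twist to the direction `a β_0 - β_{-1}`, which is outside
`sumZero` because `a ≠ 1`. So `z (-1)` and `z 0` are related modulo `q_0`. This forces `(p, r)` into
the congruence of `p_0`, although the diagonal is not below `p_0`. -/

/-! ### Commutators, centralizers and permuting congruences. -/

section CommutatorTheory

variable {S : FirstOrder.Language.{u, v}} {A : Type w} [S.Structure A]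

/-- Congruences are preserved by all term operations. -/
theorem AlgCon.realize_rel (θ : AlgCon S A) {ι : Type*} (t : S.Term ι) (p q : ι → A)
    (h : ∀ i, θ.toSetoid (p i) (q i)) : θ.toSetoid (t.realize p) (t.realize q) := by
  induction t with
  | var i => exact h i
  | func f ts ih => exact θ.map_fun f _ _ ih

theorem AlgCon.inf_rel {α β : AlgCon S A} {p q : A} (h₁ : α.toSetoid p q)
    (h₂ : β.toSetoid p q) : (α ⊓ β).toSetoid p q := by
  have h : sInf {α, β} ≤ α ⊓ β :=
    le_inf (sInf_le (by simp)) (sInf_le (by simp))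
  refine h ?_
  rintro θ (rfl | rfl)
  exacts [h₁, h₂]

/-- Modulo `α` the tuples `a` and `b` may be exchanged, which transports the assumed relation;
modulo `β` the conclusion follows from `c β d` alone. -/
theorem centralizes_inf (α β : AlgCon S A) : Centralizes α β (α ⊓ β) := by
  intro m n t a b c d hab hcd h
  refine AlgCon.inf_rel ?_ ?_
  · have key : ∀ c : Fin n → A,
        α.toSetoid (t.realize (Sum.elim a c)) (t.realize (Sum.elim b c)) := fun c =>
      α.realize_rel t _ _ (by
        rintro (i | i)
        exacts [hab i, α.toSetoid.refl' _])
    exact α.toSetoid.trans' (α.toSetoid.symm' (key c))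
      (α.toSetoid.trans' ((inf_le_left : α ⊓ β ≤ α) h) (key d))
  · exact β.realize_rel t _ _ (by
      rintro (i | i)
      exacts [β.toSetoid.refl' _, hcd i])

/-- Two elements are related if exchanging one for the other in any term preserves whether
`β`-related parameters yield `δ`-related values. -/
def CentralizerRel (β δ : AlgCon S A) (p q : A) : Prop :=
  ∀ (n : ℕ) (t : S.Term (Fin 1 ⊕ Fin n)) (c d : Fin n → A), (∀ j, β.toSetoid (c j) (d j)) →
    (δ.toSetoid (t.realize (Sum.elim (fun _ => p) c)) (t.realize (Sum.elim (fun _ => p) d)) ↔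
      δ.toSetoid (t.realize (Sum.elim (fun _ => q) c)) (t.realize (Sum.elim (fun _ => q) d)))

/-- The other variables of the first block are moved among the parameters, where they occur as
equal, hence `β`-related, pairs. -/
theorem CentralizerRel.update {β δ : AlgCon S A} {p q : A} (h : CentralizerRel β δ p q)
    {m n : ℕ} (t : S.Term (Fin m ⊕ Fin n)) (a : Fin m → A) (i : Fin m) {c d : Fin n → A}
    (hcd : ∀ j, β.toSetoid (c j) (d j)) :
    δ.toSetoid (t.realize (Sum.elim (Function.update a i p) c))
        (t.realize (Sum.elim (Function.update a i p) d)) ↔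
      δ.toSetoid (t.realize (Sum.elim (Function.update a i q) c))
        (t.realize (Sum.elim (Function.update a i q) d)) := by
  let g : Fin m ⊕ Fin n → Fin 1 ⊕ Fin (m + n) :=
    Sum.elim (fun k => if k = i then Sum.inl 0 else Sum.inr (Fin.castAdd n k))
      (fun k => Sum.inr (Fin.natAdd m k))
  have key : ∀ (r : A) (c : Fin n → A),
      (t.relabel g).realize (Sum.elim (fun _ => r) (Fin.append a c)) =
        t.realize (Sum.elim (Function.update a i r) c) := by
    intro r c
    rw [FirstOrder.Language.Term.realize_relabel]
    congr 1
    funext k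
    rcases k with k | k
    · by_cases hk : k = i
      · subst hk; simp [g]
      · simp [g, hk]
    · simp [g]
  have := h _ (t.relabel g) (Fin.append a c) (Fin.append a d) (fun j => by
    refine Fin.addCases (fun j => ?_) (fun j => ?_) j
    · simp
    · simpa using hcd j)
  simpa only [key] using this

/-- The tuple `a` is turned into `b` one coordinate at a time. -/
theorem CentralizerRel.tuple {β δ : AlgCon S A} {m n : ℕ} (t : S.Term (Fin m ⊕ Fin n))
    {a b : Fin m → A} (hab : ∀ i, CentralizerRel β δ (a i) (b i)) {c d : Fin n → A}
    (hcd : ∀ j, β.toSetoid (c j) (d j)) :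
    δ.toSetoid (t.realize (Sum.elim a c)) (t.realize (Sum.elim a d)) ↔
      δ.toSetoid (t.realize (Sum.elim b c)) (t.realize (Sum.elim b d)) := by
  classical
  have key : ∀ s : Finset (Fin m),
      (δ.toSetoid (t.realize (Sum.elim a c)) (t.realize (Sum.elim a d)) ↔
        δ.toSetoid (t.realize (Sum.elim (s.piecewise b a) c))
          (t.realize (Sum.elim (s.piecewise b a) d))) := by
    intro s
    induction s using Finset.induction_on with
    | empty => simp
    | insert i s his ih =>
      rw [ih, Finset.piecewise_insert, ← (hab i).update t (s.piecewise b a) i hcd]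
      have : Function.update (s.piecewise b a) i (a i) = s.piecewise b a := by
        rw [Function.update_eq_self_iff, Finset.piecewise_eq_of_notMem _ _ _ his]
      rw [this]
  simpa using key Finset.univ

/-- The relation `CentralizerRel β δ` as a congruence. -/
def centralizerCon (β δ : AlgCon S A) : AlgCon S A where
  r := CentralizerRel β δ
  iseqv :=
    ⟨fun _ _ _ _ _ _ => Iff.rfl, fun h n t c d hcd => (h n t c d hcd).symm,
      fun h k n t c d hcd => (h n t c d hcd).trans (k n t c d hcd)⟩
  -- Substituting `f` of `k` fresh variables for the single distinguished variable reduces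
  -- compatibility to the statement about tuples.
  map_fun := by
    intro k f p q hpq n t c d hcd
    let g : Fin 1 ⊕ Fin n → S.Term (Fin k ⊕ Fin n) :=
      Sum.elim (fun _ => FirstOrder.Language.Term.func f
        fun i => FirstOrder.Language.Term.var (Sum.inl i))
        (fun j => FirstOrder.Language.Term.var (Sum.inr j))
    have key : ∀ (p : Fin k → A) (c : Fin n → A), (t.subst g).realize (Sum.elim p c) =
        t.realize (Sum.elim (fun _ => FirstOrder.Language.Structure.funMap f p) c) := by
      intro p c
      rw [FirstOrder.Language.Term.realize_subst]
      congr 1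
      funext j
      rcases j with j | j <;> simp [g]
    have := CentralizerRel.tuple (t.subst g) hpq hcd
    simpa only [key] using this

/-- Thus `centralizerCon β δ` is the largest congruence centralizing `β` modulo `δ`; closure of
centrality under joins in the first argument is then immediate. -/
theorem centralizes_iff_le (α β δ : AlgCon S A) :
    Centralizes α β δ ↔ α ≤ centralizerCon β δ := by
  constructor
  · intro h p q hpq n t c d hcd
    exact ⟨h 1 n t _ _ c d (fun _ => hpq) hcd,
      h 1 n t _ _ c d (fun _ => α.toSetoid.symm' hpq) hcd⟩
  · intro h m n t a b c d hab hcd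
    exact (CentralizerRel.tuple t (fun i => h (hab i)) hcd).1

theorem Centralizes.sup {α₁ α₂ β δ : AlgCon S A} (h₁ : Centralizes α₁ β δ)
    (h₂ : Centralizes α₂ β δ) : Centralizes (α₁ ⊔ α₂) β δ := by
  rw [centralizes_iff_le] at *
  exact sup_le h₁ h₂

theorem Centralizes.mono_left {α₁ α₂ β δ : AlgCon S A} (h : Centralizes α₂ β δ) (hα : α₁ ≤ α₂) :
    Centralizes α₁ β δ := by
  rw [centralizes_iff_le] at *
  exact hα.trans h

/-- A congruence below the join of two congruences, each of which meets it in `δ`, is abelian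
over `δ`. -/
theorem algCommutator_self_le {α β γ δ : AlgCon S A} (h₁ : α ⊓ γ = δ) (h₂ : β ⊓ γ = δ)
    (h : γ ≤ α ⊔ β) : algCommutator γ γ ≤ δ :=
  sInf_le ((Centralizes.sup (h₁ ▸ centralizes_inf α γ) (h₂ ▸ centralizes_inf β γ)).mono_left h)

/-- Congruences `α`, `β` with `[α, α] ≤ β` and `[β, β] ≤ α` permute. -/
theorem IsWeakDifferenceTerm.permute {d : S.Term (Fin 3)} (hd : IsWeakDifferenceTerm d A)
    {α β : AlgCon S A} (hα : algCommutator α α ≤ β) (hβ : algCommutator β β ≤ α) {p q r : A}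
    (hpq : α.toSetoid p q) (hqr : β.toSetoid q r) :
    ∃ s, β.toSetoid p s ∧ α.toSetoid s r := by
  -- Modulo `β`: `p`, `d(p,q,q)`, `d(p,q,r)`, where the first step uses `[α, α] ≤ β`. Modulo `α`:
  -- `d(p,q,r)`, `d(q,q,r)`, `r`, where the last step uses `[β, β] ≤ α`.
  refine ⟨d.realize ![p, q, r], ?_, ?_⟩
  · refine β.toSetoid.trans' (hα (hd α p q hpq).1) (β.realize_rel d _ _ ?_)
    intro i
    fin_cases i
    exacts [β.toSetoid.refl' _, β.toSetoid.refl' _, hqr]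
  · refine α.toSetoid.trans' (α.realize_rel d _ ![q, q, r] ?_) (hβ (hd β q r hqr).2)
    intro i
    fin_cases i
    exacts [hpq, α.toSetoid.refl' _, α.toSetoid.refl' _]

/-- The composition of two permuting congruences. -/
def AlgCon.comp (α β : AlgCon S A)
    (h : ∀ p q r, α.toSetoid p q → β.toSetoid q r → ∃ s, β.toSetoid p s ∧ α.toSetoid s r) :
    AlgCon S A where
  r p r := ∃ q, α.toSetoid p q ∧ β.toSetoid q r
  iseqv :=
    { refl := fun p => ⟨p, α.toSetoid.refl' p, β.toSetoid.refl' p⟩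
      symm := by
        rintro p r ⟨q, hpq, hqr⟩
        obtain ⟨s, hps, hsr⟩ := h p q r hpq hqr
        exact ⟨s, α.toSetoid.symm' hsr, β.toSetoid.symm' hps⟩
      trans := by
        rintro p r t ⟨q, hpq, hqr⟩ ⟨s, hrs, hst⟩
        obtain ⟨k, hk₁, hk₂⟩ := h s r q (α.toSetoid.symm' hrs) (β.toSetoid.symm' hqr)
        exact ⟨k, α.toSetoid.trans' hpq (α.toSetoid.symm' hk₂),
          β.toSetoid.trans' (β.toSetoid.symm' hk₁) hst⟩ }
  map_fun f p r hpr := by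
    choose q hpq hqr using hpr
    exact ⟨FirstOrder.Language.Structure.funMap f q, α.map_fun f _ _ hpq, β.map_fun f _ _ hqr⟩

/-- If `α`, `β`, `γ` pairwise have the meet `δ`, and `α ≤ β ⊔ γ` and `β ≤ α ⊔ γ`, then the join of
`α` and `β` is their composition. -/
theorem IsWeakDifferenceTerm.exists_of_sup_rel {d : S.Term (Fin 3)}
    (hd : IsWeakDifferenceTerm d A) {α β γ δ : AlgCon S A} (hαβ : α ⊓ β = δ) (hαγ : γ ⊓ α = δ)
    (hβγ : γ ⊓ β = δ) (hα : α ≤ β ⊔ γ) (hβ : β ≤ α ⊔ γ) {p r : A}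
    (hpr : (α ⊔ β).toSetoid p r) : ∃ q, α.toSetoid p q ∧ β.toSetoid q r := by
  have h₁ : algCommutator α α ≤ β :=
    (algCommutator_self_le (inf_comm α β ▸ hαβ) hαγ hα).trans (hαβ ▸ inf_le_right)
  have h₂ : algCommutator β β ≤ α :=
    (algCommutator_self_le hαβ hβγ hβ).trans (hαβ ▸ inf_le_left)
  have h : α ⊔ β ≤ AlgCon.comp α β (fun _ _ _ => hd.permute h₁ h₂) :=
    sup_le (fun p q hpq => ⟨q, hpq, β.toSetoid.refl' q⟩)
      (fun p q hpq => ⟨p, α.toSetoid.refl' p, hpq⟩)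
  exact h hpr

/-- The lattice version of `IsWeakDifferenceTerm.exists_of_sup_rel` for a lattice of congruences. -/
theorem IsWeakDifferenceTerm.exists_of_map_sup_rel {d : S.Term (Fin 3)}
    (hd : IsWeakDifferenceTerm d A) {L : Type*} [Lattice L] (f : LatticeHom L (AlgCon S A))
    {α β γ δ : L} (hαβ : α ⊓ β = δ) (hαγ : γ ⊓ α = δ)
    (hβγ : γ ⊓ β = δ) (hα : α ≤ β ⊔ γ) (hβ : β ≤ α ⊔ γ) {p r : A}
    (hpr : (f (α ⊔ β)).toSetoid p r) : ∃ q, (f α).toSetoid p q ∧ (f β).toSetoid q r := by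
  have hf : Monotone f := OrderHomClass.mono f
  rw [map_sup] at hpr
  refine hd.exists_of_sup_rel (γ := f γ) (δ := f δ) ?_ ?_ ?_ ?_ ?_ hpr
  · rw [← map_inf, hαβ]
  · rw [← map_inf, hαγ]
  · rw [← map_inf, hβγ]
  · rw [← map_sup]; exact hf hα
  · rw [← map_sup]; exact hf hβ

theorem map_inf_rel {L : Type*} [Lattice L] (f : LatticeHom L (AlgCon S A)) {α β γ : L}
    (h : α ⊓ β ≤ γ) {p q : A} (h₁ : (f α).toSetoid p q) (h₂ : (f β).toSetoid p q) :
    (f γ).toSetoid p q := by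
  refine (OrderHomClass.mono f : Monotone f) h ?_
  rw [map_inf]
  exact AlgCon.inf_rel h₁ h₂

end CommutatorTheory

/-! ### Planes: Desargues' theorem from permuting point congruences. -/

namespace PlaneSubspace

variable {P Λ : Type*} [Membership P Λ]

/-- A point as a subspace. -/
def point (Λ : Type*) [Membership P Λ] (p : P) : PlaneSubspace P Λ where
  carrier := {p}
  line_subset := by
    rintro l _ _ rfl rfl h
    exact absurd rfl h

/-- The subspace without points. -/
def none (P Λ : Type*) [Membership P Λ] : PlaneSubspace P Λ where
  carrier := ∅
  line_subset := fun _ _ _ h => absurd h (Set.notMem_empty _)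

/-- A line as a subspace. -/
def line [Configuration.Nondegenerate P Λ] (l : Λ) : PlaneSubspace P Λ where
  carrier := {p | p ∈ l}
  line_subset := by
    intro k p q hp hq hpq hpk hqk r hr
    obtain h | rfl := Configuration.Nondegenerate.eq_or_eq (P := P) (L := Λ) hp hq hpk hqk
    · exact absurd h hpq
    · exact hr

theorem point_le {p : P} {U : PlaneSubspace P Λ} : point Λ p ≤ U ↔ p ∈ U.carrier :=
  Set.singleton_subset_iff

theorem inf_le_of_subset {U V W : PlaneSubspace P Λ} (h : U.carrier ∩ V.carrier ⊆ W.carrier) :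
    U ⊓ V ≤ W := fun _ hp =>
  h ⟨(inf_le_left : U ⊓ V ≤ U) hp, (inf_le_right : U ⊓ V ≤ V) hp⟩

theorem none_le (U : PlaneSubspace P Λ) : none P Λ ≤ U := Set.empty_subset _

theorem point_inf_point {p q : P} (h : p ≠ q) : point Λ p ⊓ point Λ q = none P Λ :=
  le_antisymm
    (inf_le_of_subset (by
      rintro _ ⟨rfl, h'⟩
      exact absurd h' h)) (none_le _)

theorem point_le_sup {p q r : P} {l : Λ} (hp : p ∈ l) (hq : q ∈ l) (hr : r ∈ l) (hqr : q ≠ r) :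
    point Λ p ≤ point Λ q ⊔ point Λ r :=
  point_le.2 ((point Λ q ⊔ point Λ r).line_subset l q r (point_le.1 le_sup_left)
    (point_le.1 le_sup_right) hqr hq hr p hp)

/-- Three distinct points of a line meet pairwise in the empty subspace, and each is below the join
of the other two, so the interpolation result applies to them. -/
theorem exists_of_rel_point {S : FirstOrder.Language.{u, v}} {A : Type w} [S.Structure A]
    {d : S.Term (Fin 3)} (hd : IsWeakDifferenceTerm d A)
    (f : LatticeHom (PlaneSubspace P Λ) (AlgCon S A)) {o p q : P} {l : Λ} (ho : o ∈ l)
    (hp : p ∈ l) (hq : q ∈ l) (hpo : p ≠ o) (hqo : q ≠ o) (hpq : p ≠ q) {s t : A}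
    (h : (f (point Λ o)).toSetoid s t) :
    ∃ r, (f (point Λ p)).toSetoid s r ∧ (f (point Λ q)).toSetoid r t :=
  hd.exists_of_map_sup_rel f (point_inf_point hpq) (point_inf_point hpo.symm)
    (point_inf_point hqo.symm) (point_le_sup hp hq ho hqo) (point_le_sup hq hp ho hpo)
    ((OrderHomClass.mono f : Monotone f) (point_le_sup ho hp hq hpq) h)

end PlaneSubspace

open PlaneSubspace in
theorem isDesarguesian_of_latticeHom {S : FirstOrder.Language.{u, v}} {A : Type w}
    [S.Structure A] {d : S.Term (Fin 3)} (hd : IsWeakDifferenceTerm d A) (P : Type y) (Λ : Type z)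
    [Membership P Λ] [Configuration.ProjectivePlane P Λ]
    (f : LatticeHom (PlaneSubspace P Λ) (AlgCon S A)) (hf : Function.Injective f) :
    IsDesarguesian P Λ := by
  have unique : ∀ {p q : P} {k l : Λ}, p ∈ k → q ∈ k → p ∈ l → q ∈ l → p = q ∨ k = l :=
    Configuration.Nondegenerate.eq_or_eq
  -- Three points of which two coincide are collinear. This covers the degenerate case `c 0 = c 1`,
  -- even when `c 2` is the same point too.
  have exists_line : ∀ p q r : P, p = q → ∃ k : Λ, p ∈ k ∧ q ∈ k ∧ r ∈ k := by
    rintro p _ r rfl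
    by_cases h : p = r
    · obtain ⟨s, hs⟩ : ∃ s, s ≠ p := by
        obtain ⟨p₁, p₂, -, -, l₂, -, hp₁, -, -, hp₂, -⟩ :=
          Configuration.ProjectivePlane.exists_config (P := P) (L := Λ)
        by_contra! hp
        exact hp₁ (hp p₁ ▸ hp p₂ ▸ hp₂)
      have := Configuration.HasLines.mkLine_ax (P := P) (L := Λ) hs
      exact ⟨_, this.2, this.2, h ▸ this.2⟩
    · have := Configuration.HasLines.mkLine_ax (P := P) (L := Λ) h
      exact ⟨_, this.1, this.1, this.2⟩
  have hmono : Monotone f := OrderHomClass.mono f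
  intro o l a b g h c hl hab ha hb hgh hc
  by_contra hk
  have hl' : ∀ i j, i ≠ j → ∀ p : P, p ∈ l i → p ∈ l j → p = o := fun i j hij p hi hj =>
    (unique hi (hab i).1 hj (hab j).1).resolve_right (hl.ne hij)
  have haa : ∀ i j, i ≠ j → a i ≠ a j := fun i j hij h' =>
    (hab i).2.2.2.1 (hl' i j hij _ (hab i).2.1 (h' ▸ (hab j).2.1))
  have hbb : ∀ i j, i ≠ j → b i ≠ b j := fun i j hij h' =>
    (hab i).2.2.2.2.1 (hl' i j hij _ (hab i).2.2.1 (h' ▸ (hab j).2.2.1))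
  -- A common side would contain `a j ≠ b j` and `a k ≠ b k`, hence would equal both `l j` and `l
  -- k`.
  have hne : ∀ i j k, j ≠ i → k ≠ i → j ≠ k → g i ≠ h i := by
    intro i j k hj hk hjk h'
    have key : ∀ j, j ≠ i → g i = l j := fun j hj =>
      (unique (hgh i j hj).1 (h' ▸ (hgh i j hj).2) (hab j).2.1 (hab j).2.2.1).resolve_left
        (hab j).2.2.2.2.2
    exact hl.ne hjk ((key j hj).symm.trans (key k hk))
  have hc01 : c 0 ≠ c 1 := fun h' => by
    obtain ⟨k, h₀, h₁, h₂⟩ := exists_line _ _ (c 2) h'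
    exact hk ⟨k, by intro i; fin_cases i; exacts [h₀, h₁, h₂]⟩
  have hline := Configuration.HasLines.mkLine_ax (P := P) (L := Λ) hc01
  generalize (Configuration.HasLines.mkLine hc01 : Λ) = k at hline
  have hc2 : c 2 ∉ k := fun h₂ =>
    hk ⟨k, by intro i; fin_cases i; exacts [hline.1, hline.2, h₂]⟩
  suffices H : point Λ o ≤ PlaneSubspace.none P Λ from (point_le.1 H : o ∈ (∅ : Set P))
  have hsub : f (point Λ o) ≤ f (PlaneSubspace.none P Λ) := by
    intro s t hst
    have hz : ∀ i, ∃ r, (f (point Λ (a i))).toSetoid s r ∧ (f (point Λ (b i))).toSetoid r t :=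
      fun i => exists_of_rel_point hd f (hab i).1 (hab i).2.1 (hab i).2.2.1 (hab i).2.2.2.1
        (hab i).2.2.2.2.1 (hab i).2.2.2.2.2 hst
    choose r hsr hrt using hz
    -- The path from `r j` to `r k` through `s` stays within the side `g i`, the one through `t`
    -- within `h i`; these two lines meet only in `c i`.
    have hrr : ∀ i j k, j ≠ i → k ≠ i → j ≠ k →
        (f (point Λ (c i))).toSetoid (r j) (r k) := by
      intro i j k hj hk hjk
      refine map_inf_rel f (α := line (g i)) (β := line (h i)) (inf_le_of_subset ?_)
        ((f _).toSetoid.trans' ((f _).toSetoid.symm'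
          (hmono (point_le.2 (hgh i j hj).1) (hsr j))) (hmono (point_le.2 (hgh i k hk).1) (hsr k)))
        ((f _).toSetoid.trans' (hmono (point_le.2 (hgh i j hj).2) (hrt j))
          ((f _).toSetoid.symm' (hmono (point_le.2 (hgh i k hk).2) (hrt k))))
      rintro p ⟨hpg, hph⟩
      exact (unique hpg (hc i).1 hph (hc i).2).resolve_right (hne i j k hj hk hjk)
    -- Directly the pair is related by `c 2`; through `r 2` it is related by the line joining `c 0`
    -- and `c 1`, which misses `c 2`.
    have h01 : (f (PlaneSubspace.none P Λ)).toSetoid (r 0) (r 1) := by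
      refine map_inf_rel f (α := point Λ (c 2)) (β := line k) (inf_le_of_subset ?_)
        (hrr 2 0 1 (by decide) (by decide) (by decide))
        ((f _).toSetoid.trans'
          (hmono (point_le.2 hline.2) (hrr 1 0 2 (by decide) (by decide) (by decide)))
          (hmono (point_le.2 hline.1) (hrr 0 2 1 (by decide) (by decide) (by decide))))
      rintro _ ⟨rfl, h'⟩
      exact hc2 h'
    have hs : (f (PlaneSubspace.none P Λ)).toSetoid s (r 0) :=
      map_inf_rel f (point_inf_point (haa 0 1 (by decide))).le (hsr 0)
        ((f _).toSetoid.trans' (hsr 1) ((f _).toSetoid.symm' (hmono (none_le _) h01)))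
    have ht : (f (PlaneSubspace.none P Λ)).toSetoid (r 0) t :=
      map_inf_rel f (point_inf_point (hbb 0 1 (by decide))).le (hrt 0)
        ((f _).toSetoid.trans' (hmono (none_le _) h01) (hrt 1))
    exact (f _).toSetoid.trans' hs ht
  have := hf (le_antisymm hsub (hmono (none_le _)))
  exact this.le

/-! ### Haiman's lattices: reducing the order to inclusion away from `[m, 1]`. -/

namespace HaimanLattice

variable {F : Type*} [Field F] {n : ℕ} {a : Fˣ}

/-- A missing `α_i` certifies that a subspace is not above `m`, so that the order below it is plain
inclusion, unaffected by the twist. -/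
theorem not_mem_le {x : Submodule F (Haiman.Space F n)} (i : ZMod n)
    (h : Pi.single (Sum.inl i) 1 ∉ x) : ¬ Haiman.coord F n (Haiman.mIdx n) ≤ x := fun hm =>
  h (hm (by
    intro k hk
    rw [Pi.single_apply, if_neg]
    rintro rfl
    exact hk ⟨i, rfl⟩))

theorem le_of_toSubmodule_le {x y : HaimanLattice F n a} (i : ZMod n)
    (h : Pi.single (Sum.inl i) 1 ∉ y.toSubmodule) (hxy : x.toSubmodule ≤ y.toSubmodule) :
    x ≤ y :=
  (le_iff_of_not_le (not_mem_le i h)).2 hxy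

theorem toSubmodule_le {x y : HaimanLattice F n a} (i : ZMod n)
    (h : Pi.single (Sum.inl i) 1 ∉ y.toSubmodule) (hxy : x ≤ y) :
    x.toSubmodule ≤ y.toSubmodule :=
  (le_iff_of_not_le (not_mem_le i h)).1 hxy

variable [Fact (3 ≤ n)]

/-- The bound `w` keeps the sum of subspaces from containing `m`; in that case the join is the
ordinary sum. -/
theorem le_sup_of_toSubmodule_le {x y z : HaimanLattice F n a} (i : ZMod n)
    {w : Submodule F (Haiman.Space F n)} (h : Pi.single (Sum.inl i) 1 ∉ w)
    (hx : x.toSubmodule ≤ w) (hy : y.toSubmodule ≤ w)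
    (hz : z.toSubmodule ≤ x.toSubmodule ⊔ y.toSubmodule) : z ≤ x ⊔ y := by
  have hm : ¬ Haiman.coord F n (Haiman.mIdx n) ≤ x.toSubmodule ⊔ y.toSubmodule := fun h' =>
    not_mem_le i h (h'.trans (sup_le hx hy))
  have : x ⊔ y =
      ⟨x.toSubmodule ⊔ y.toSubmodule, Haiman.sup_mem_blocks F n x.mem_blocks y.mem_blocks⟩ :=
    dif_neg hm
  rw [this]
  exact (le_iff_of_not_le hm).2 hz

theorem inf_le_of_forall {x y z : HaimanLattice F n a} (i j k : ZMod n)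
    (hx : Pi.single (Sum.inl i) 1 ∉ x.toSubmodule) (hy : Pi.single (Sum.inl j) 1 ∉ y.toSubmodule)
    (hz : Pi.single (Sum.inl k) 1 ∉ z.toSubmodule)
    (h : ∀ v ∈ x.toSubmodule, v ∈ y.toSubmodule → v ∈ z.toSubmodule) : x ⊓ y ≤ z :=
  le_of_toSubmodule_le k hz fun v hv =>
    h v (toSubmodule_le i hx inf_le_left hv) (toSubmodule_le j hy inf_le_right hv)

end HaimanLattice

/-! ### The elements of the configuration and their relations. -/

namespace HaimanLattice

section Elements

variable {F : Type*} [Field F] {n : ℕ} {a : Fˣ}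

/-- The element of `[p_i, r_i]` cut out by linear equations, each given by the coefficients of the
coordinates with respect to `α_i`, `α_{i+1}`, `β_i`. -/
def prElt (a : Fˣ) (i : ZMod n) (s : Set (Fin 3 → F)) : HaimanLattice F n a where
  toSubmodule :=
    { carrier := {v | (∀ x ∈ s,
          x 0 * v (Sum.inl i) + x 1 * v (Sum.inl (i + 1)) + x 2 * v (Sum.inr i) = 0) ∧
        ∀ j, j ≠ i → v (Sum.inr j) = 0}
      add_mem' := fun {v w} hv hw => ⟨fun x hx => by
        simp only [Pi.add_apply]
        linear_combination hv.1 x hx + hw.1 x hx, fun j hj => by simp [hv.2 j hj, hw.2 j hj]⟩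
      zero_mem' := by simp
      smul_mem' := fun c v hv => ⟨fun x hx => by
        simp only [Pi.smul_apply, smul_eq_mul]
        linear_combination c * hv.1 x hx, fun j hj => by simp [hv.2 j hj]⟩ }
  mem_blocks := by
    refine Or.inr (Or.inr (Or.inl ⟨i, fun v hv => ⟨fun x _ => ?_, fun j _ => ?_⟩, fun v hv => ?_⟩))
    · rw [hv (Sum.inl i), hv (Sum.inl (i + 1)), hv (Sum.inr i)] <;> simp [Haiman.pIdx]
    · exact hv _ (by simp [Haiman.pIdx])
    · rintro (j | j) hj
      · exact absurd (Or.inl ⟨j, rfl⟩) hj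
      · exact hv.2 j fun h => hj (Or.inr (by simp [h]))

/-- The element of `[q_i, s_i]` cut out by linear equations, each given by the coefficients of the
coordinates with respect to `α_i`, `β_{i-1}`, `β_i`. -/
def qsElt (a : Fˣ) (i : ZMod n) (s : Set (Fin 3 → F)) : HaimanLattice F n a where
  toSubmodule :=
    { carrier := {v | (∀ x ∈ s,
          x 0 * v (Sum.inl i) + x 1 * v (Sum.inr (i - 1)) + x 2 * v (Sum.inr i) = 0) ∧
        ∀ j, j ≠ i - 1 → j ≠ i → v (Sum.inr j) = 0}
      add_mem' := fun {v w} hv hw => ⟨fun x hx => by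
        simp only [Pi.add_apply]
        linear_combination hv.1 x hx + hw.1 x hx,
        fun j hj hj' => by simp [hv.2 j hj hj', hw.2 j hj hj']⟩
      zero_mem' := by simp
      smul_mem' := fun c v hv => ⟨fun x hx => by
        simp only [Pi.smul_apply, smul_eq_mul]
        linear_combination c * hv.1 x hx, fun j hj hj' => by simp [hv.2 j hj hj']⟩ }
  mem_blocks := by
    refine Or.inr (Or.inr (Or.inr ⟨i, fun v hv => ⟨fun x _ => ?_, fun j _ _ => ?_⟩, fun v hv => ?_⟩))
    · rw [hv (Sum.inl i), hv (Sum.inr (i - 1)), hv (Sum.inr i)] <;> simp [Haiman.qIdx]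
    · exact hv _ (by simp [Haiman.qIdx])
    · rintro (j | j) hj
      · exact absurd (Or.inl ⟨j, rfl⟩) hj
      · exact hv.2 j (fun h => hj (Or.inr (by simp [h]))) fun h => hj (Or.inr (by simp [h]))

/-- The one-dimensional subspace spanned by the sum of all `α_i`. -/
def diagonal (a : Fˣ) (n : ℕ) : HaimanLattice F n a where
  toSubmodule :=
    { carrier := {v | (∀ i j, v (Sum.inl i) = v (Sum.inl j)) ∧ ∀ j, v (Sum.inr j) = 0}
      add_mem' := fun {v w} hv hw =>
        ⟨fun i j => by simp [hv.1 i j, hw.1 i j], fun j => by simp [hv.2 j, hw.2 j]⟩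
      zero_mem' := by simp
      smul_mem' := fun c v hv => ⟨fun i j => by simp [hv.1 i j], fun j => by simp [hv.2 j]⟩ }
  mem_blocks := by
    refine Or.inl fun v hv => ?_
    rintro (j | j) hj
    · exact absurd ⟨j, rfl⟩ hj
    · exact hv.2 j

/-- The hyperplane of the vectors whose `β`-coordinates have sum zero. -/
def sumZero [NeZero n] (a : Fˣ) : HaimanLattice F n a where
  toSubmodule :=
    { carrier := {v | ∑ j, v (Sum.inr j) = 0}
      add_mem' := fun {v w} hv hw => by
        simp only [Set.mem_ofPred_eq, Pi.add_apply, Finset.sum_add_distrib] at *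
        rw [hv, hw, add_zero]
      zero_mem' := by simp
      smul_mem' := fun c v hv => by
        simp only [Set.mem_ofPred_eq, Pi.smul_apply, smul_eq_mul, ← Finset.mul_sum] at *
        rw [hv, mul_zero] }
  mem_blocks := by
    refine Or.inr (Or.inl fun v hv => ?_)
    exact Finset.sum_eq_zero fun j _ => hv _ (by simp [Haiman.mIdx])

theorem mem_prElt {i : ZMod n} {s : Set (Fin 3 → F)} {v : Haiman.Space F n} :
    v ∈ (prElt a i s).toSubmodule ↔
      (∀ x ∈ s, x 0 * v (Sum.inl i) + x 1 * v (Sum.inl (i + 1)) + x 2 * v (Sum.inr i) = 0) ∧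
        ∀ j, j ≠ i → v (Sum.inr j) = 0 := Iff.rfl

theorem mem_qsElt {i : ZMod n} {s : Set (Fin 3 → F)} {v : Haiman.Space F n} :
    v ∈ (qsElt a i s).toSubmodule ↔
      (∀ x ∈ s, x 0 * v (Sum.inl i) + x 1 * v (Sum.inr (i - 1)) + x 2 * v (Sum.inr i) = 0) ∧
        ∀ j, j ≠ i - 1 → j ≠ i → v (Sum.inr j) = 0 := Iff.rfl

theorem mem_diagonal {v : Haiman.Space F n} :
    v ∈ (diagonal a n).toSubmodule ↔
      (∀ i j, v (Sum.inl i) = v (Sum.inl j)) ∧ ∀ j, v (Sum.inr j) = 0 := Iff.rfl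

theorem mem_sumZero [NeZero n] {v : Haiman.Space F n} :
    v ∈ (sumZero a).toSubmodule ↔ ∑ j, v (Sum.inr j) = 0 := Iff.rfl

/-- The subspace `p_i`. -/
def pElt (a : Fˣ) (i : ZMod n) : HaimanLattice F n a := prElt a i {![1, 0, 0], ![0, 1, 0], ![0, 0, 1]}

/-- The subspace `q_i`. -/
def qElt (a : Fˣ) (i : ZMod n) : HaimanLattice F n a := qsElt a i {![1, 0, 0], ![0, 1, 0], ![0, 0, 1]}

/-- The subspace `p_i + ⟨β_i⟩`. -/
def xElt (a : Fˣ) (i : ZMod n) : HaimanLattice F n a := prElt a i {![1, 0, 0], ![0, 1, 0]}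

/-- The subspace `p_i + ⟨β_i + α_i + α_{i+1}⟩`. -/
def yElt (a : Fˣ) (i : ZMod n) : HaimanLattice F n a := prElt a i {![1, 0, -1], ![0, 1, -1]}

/-- The subspace `p_i + ⟨α_i + α_{i+1}⟩`. -/
def tElt (a : Fˣ) (i : ZMod n) : HaimanLattice F n a := prElt a i {![1, -1, 0], ![0, 0, 1]}

/-- The subspace `q_i + ⟨β_i - β_{i-1}⟩`. -/
def cElt (a : Fˣ) (i : ZMod n) : HaimanLattice F n a := qsElt a i {![1, 0, 0], ![0, 1, 1]}

theorem mem_pElt {i : ZMod n} {v : Haiman.Space F n} : v ∈ (pElt a i).toSubmodule ↔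
    (v (Sum.inl i) = 0 ∧ v (Sum.inl (i + 1)) = 0 ∧ v (Sum.inr i) = 0) ∧
      ∀ j, j ≠ i → v (Sum.inr j) = 0 := by
  simp [pElt, mem_prElt]

theorem mem_qElt {i : ZMod n} {v : Haiman.Space F n} : v ∈ (qElt a i).toSubmodule ↔
    (v (Sum.inl i) = 0 ∧ v (Sum.inr (i - 1)) = 0 ∧ v (Sum.inr i) = 0) ∧
      ∀ j, j ≠ i - 1 → j ≠ i → v (Sum.inr j) = 0 := by
  simp [qElt, mem_qsElt]

theorem mem_xElt {i : ZMod n} {v : Haiman.Space F n} : v ∈ (xElt a i).toSubmodule ↔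
    (v (Sum.inl i) = 0 ∧ v (Sum.inl (i + 1)) = 0) ∧ ∀ j, j ≠ i → v (Sum.inr j) = 0 := by
  simp [xElt, mem_prElt]

theorem mem_yElt {i : ZMod n} {v : Haiman.Space F n} : v ∈ (yElt a i).toSubmodule ↔
    (v (Sum.inl i) = v (Sum.inr i) ∧ v (Sum.inl (i + 1)) = v (Sum.inr i)) ∧
      ∀ j, j ≠ i → v (Sum.inr j) = 0 := by
  simp [yElt, mem_prElt, add_neg_eq_zero]

theorem mem_tElt {i : ZMod n} {v : Haiman.Space F n} : v ∈ (tElt a i).toSubmodule ↔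
    (v (Sum.inl i) = v (Sum.inl (i + 1)) ∧ v (Sum.inr i) = 0) ∧
      ∀ j, j ≠ i → v (Sum.inr j) = 0 := by
  simp [tElt, mem_prElt, add_neg_eq_zero]

theorem mem_cElt {i : ZMod n} {v : Haiman.Space F n} : v ∈ (cElt a i).toSubmodule ↔
    (v (Sum.inl i) = 0 ∧ v (Sum.inr (i - 1)) + v (Sum.inr i) = 0) ∧
      ∀ j, j ≠ i - 1 → j ≠ i → v (Sum.inr j) = 0 := by
  simp [cElt, mem_qsElt]

theorem single_notMem_pElt (i : ZMod n) :
    Pi.single (Sum.inl i) 1 ∉ (pElt (F := F) a i).toSubmodule := by simp [mem_pElt]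

theorem single_notMem_qElt (i : ZMod n) :
    Pi.single (Sum.inl i) 1 ∉ (qElt (F := F) a i).toSubmodule := by simp [mem_qElt]

theorem single_notMem_xElt (i : ZMod n) :
    Pi.single (Sum.inl i) 1 ∉ (xElt (F := F) a i).toSubmodule := by simp [mem_xElt]

theorem single_notMem_yElt (i : ZMod n) :
    Pi.single (Sum.inl i) 1 ∉ (yElt (F := F) a i).toSubmodule := by simp [mem_yElt]

theorem single_notMem_cElt (i : ZMod n) :
    Pi.single (Sum.inl i) 1 ∉ (cElt (F := F) a i).toSubmodule := by simp [mem_cElt]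

theorem not_diagonal_le_pElt (i : ZMod n) : ¬ diagonal (F := F) a n ≤ pElt a i := by
  intro h
  have h' := toSubmodule_le i (single_notMem_pElt i) h
  have : (Sum.elim 1 0 : Haiman.Space F n) ∈ (diagonal a n).toSubmodule := by simp [mem_diagonal]
  simpa using (mem_pElt.1 (h' this)).1.1

theorem coord_le_sumZero [NeZero n] :
    Haiman.coord F n (Haiman.mIdx n) ≤ (sumZero (F := F) a).toSubmodule := fun v hv =>
  Finset.sum_eq_zero fun j _ => hv _ (by simp [Haiman.mIdx])

variable [hn : Fact (3 ≤ n)]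

theorem add_one_ne (i : ZMod n) : i + 1 ≠ i := by
  simpa using Haiman.one_ne_zero_zmod n

theorem single_notMem_tElt (i : ZMod n) :
    Pi.single (Sum.inl i) 1 ∉ (tElt (F := F) a i).toSubmodule := by
  simp [mem_tElt, add_one_ne i]

theorem xElt_inf_yElt (i : ZMod n) : xElt (F := F) a i ⊓ yElt a i = pElt a i := by
  refine le_antisymm (inf_le_of_forall i i i (single_notMem_xElt i) (single_notMem_yElt i)
    (single_notMem_pElt i) fun v hx hy => ?_) (le_inf
      (le_of_toSubmodule_le i (single_notMem_xElt i) fun v hv => ?_)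
      (le_of_toSubmodule_le i (single_notMem_yElt i) fun v hv => ?_))
  all_goals simp only [mem_pElt, mem_xElt, mem_yElt] at * <;> grind

theorem tElt_inf_xElt (i : ZMod n) : tElt (F := F) a i ⊓ xElt a i = pElt a i := by
  refine le_antisymm (inf_le_of_forall i i i (single_notMem_tElt i) (single_notMem_xElt i)
    (single_notMem_pElt i) fun v hx hy => ?_) (le_inf
      (le_of_toSubmodule_le i (single_notMem_tElt i) fun v hv => ?_)
      (le_of_toSubmodule_le i (single_notMem_xElt i) fun v hv => ?_))
  all_goals simp only [mem_pElt, mem_xElt, mem_tElt] at * <;> grind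

theorem tElt_inf_yElt (i : ZMod n) : tElt (F := F) a i ⊓ yElt a i = pElt a i := by
  refine le_antisymm (inf_le_of_forall i i i (single_notMem_tElt i) (single_notMem_yElt i)
    (single_notMem_pElt i) fun v hx hy => ?_) (le_inf
      (le_of_toSubmodule_le i (single_notMem_tElt i) fun v hv => ?_)
      (le_of_toSubmodule_le i (single_notMem_yElt i) fun v hv => ?_))
  all_goals simp only [mem_pElt, mem_yElt, mem_tElt] at * <;> grind

/-- The line of `[p_i, r_i]` joining `xElt i`, `yElt i` and `tElt i`. -/
theorem le_sup_of_mem_line {x y z : HaimanLattice F n a} (i : ZMod n)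
    (hx : ∀ v ∈ x.toSubmodule, v (Sum.inl i) = v (Sum.inl (i + 1)))
    (hy : ∀ v ∈ y.toSubmodule, v (Sum.inl i) = v (Sum.inl (i + 1)))
    (h : ∀ v ∈ z.toSubmodule, ∃ w ∈ x.toSubmodule, v - w ∈ y.toSubmodule) : z ≤ x ⊔ y := by
  -- The bound is the hyperplane on which the coordinates at `α_i` and `α_{i+1}` agree; it omits
  -- `α_i` because `i + 1 ≠ i`.
  refine le_sup_of_toSubmodule_le i
    (w := LinearMap.ker ((LinearMap.proj (Sum.inl i) : Haiman.Space F n →ₗ[F] F) -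
      LinearMap.proj (Sum.inl (i + 1)))) ?_ ?_ ?_ ?_
  · simp [add_one_ne i]
  · intro v hv
    simp [hx v hv]
  · intro v hv
    simp [hy v hv]
  · intro v hv
    obtain ⟨w, hw, hvw⟩ := h v hv
    rw [← add_sub_cancel w v]
    exact Submodule.add_mem_sup hw hvw

theorem xElt_le_sup (i : ZMod n) : xElt (F := F) a i ≤ yElt a i ⊔ tElt a i := by
  have h1 := add_one_ne i
  -- The witness is the `β_i`-coordinate of `v` times `β_i + α_i + α_{i+1}`.
  refine le_sup_of_mem_line i (fun v hv => ?_) (fun v hv => ?_) fun v hv =>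
    ⟨fun k => if k = Sum.inl i ∨ k = Sum.inl (i + 1) ∨ k = Sum.inr i then v (Sum.inr i) else 0,
      ?_, ?_⟩
  all_goals simp only [mem_xElt, mem_yElt, mem_tElt, Pi.sub_apply] at * <;> grind

theorem yElt_le_sup (i : ZMod n) : yElt (F := F) a i ≤ xElt a i ⊔ tElt a i := by
  have h1 := add_one_ne i
  refine le_sup_of_mem_line i (fun v hv => ?_) (fun v hv => ?_) fun v hv =>
    ⟨fun k => if k = Sum.inr i then v (Sum.inr i) else 0, ?_, ?_⟩
  all_goals simp only [mem_xElt, mem_yElt, mem_tElt, Pi.sub_apply] at * <;> grind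

theorem diagonal_le_sup (i : ZMod n) : diagonal (F := F) a n ≤ xElt a i ⊔ yElt a i := by
  have h1 := add_one_ne i
  -- Modulo `p_i`, the vector `α_i + α_{i+1}` is `(β_i + α_i + α_{i+1}) - β_i`.
  refine le_sup_of_mem_line i (fun v hv => ?_) (fun v hv => ?_) fun v hv =>
    ⟨fun k => if k = Sum.inr i then - v (Sum.inl i) else 0, ?_, ?_⟩
  all_goals simp only [mem_xElt, mem_yElt, mem_diagonal, Pi.sub_apply] at * <;> grind

/-- Both bounds are hyperplanes of `s_i` above `q_i`. In coordinates `s` is `α_i = 0` and `t` is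
`α_i = β_{i-1} + β_i`; together they give `β_{i-1} + β_i = 0`. Upper bounds suffice, so the joins
need not be computed. -/
theorem exists_cElt_bounds (i : ZMod n) : ∃ s t : HaimanLattice F n a,
    xElt a i ≤ s ∧ xElt a (i - 1) ≤ s ∧ yElt a i ≤ t ∧ yElt a (i - 1) ≤ t ∧ s ⊓ t ≤ cElt a i := by
  have h1 := add_one_ne (i - 1)
  have hs : Pi.single (Sum.inl i) 1 ∉ (qsElt (F := F) a i {![1, 0, 0]}).toSubmodule := by
    simp [mem_qsElt]
  have ht : Pi.single (Sum.inl i) 1 ∉ (qsElt (F := F) a i {![1, -1, -1]}).toSubmodule := by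
    simp [mem_qsElt]
  refine ⟨_, _, le_of_toSubmodule_le i hs fun v hv => ?_, le_of_toSubmodule_le i hs fun v hv => ?_,
    le_of_toSubmodule_le i ht fun v hv => ?_, le_of_toSubmodule_le i ht fun v hv => ?_,
    inf_le_of_forall i i i hs ht (single_notMem_cElt i) fun v hv hv' => ?_⟩
  all_goals simp [mem_xElt, mem_yElt, mem_cElt, mem_qsElt] at * <;> grind

/-- The bound is `q_i + ⟨β_{i-1}⟩`. It serves to pass from a relation modulo `q_i` between
neighbouring interpolants to one modulo `p_i`. -/
theorem exists_xElt_bound (i : ZMod n) : ∃ s : HaimanLattice F n a,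
    xElt a (i - 1) ≤ s ∧ qElt a i ≤ s ∧ xElt a i ⊓ s ≤ pElt a i := by
  have h1 := add_one_ne (i - 1)
  have hs : Pi.single (Sum.inl i) 1 ∉
      (qsElt (F := F) a i {![1, 0, 0], ![0, 0, 1]}).toSubmodule := by
    simp [mem_qsElt]
  refine ⟨_, le_of_toSubmodule_le i hs fun v hv => ?_, le_of_toSubmodule_le i hs fun v hv => ?_,
    inf_le_of_forall i i i (single_notMem_xElt i) hs (single_notMem_pElt i) fun v hv hv' => ?_⟩
  all_goals simp [mem_xElt, mem_pElt, mem_qElt, mem_qsElt] at * <;> grind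

/-- The analogous bound is `q_i + ⟨β_{i-1} + α_i⟩`. -/
theorem exists_yElt_bound (i : ZMod n) : ∃ s : HaimanLattice F n a,
    yElt a (i - 1) ≤ s ∧ qElt a i ≤ s ∧ yElt a i ⊓ s ≤ pElt a i := by
  have h1 := add_one_ne (i - 1)
  have hs : Pi.single (Sum.inl i) 1 ∉
      (qsElt (F := F) a i {![1, -1, 0], ![0, 0, 1]}).toSubmodule := by
    simp [mem_qsElt]
  refine ⟨_, le_of_toSubmodule_le i hs fun v hv => ?_, le_of_toSubmodule_le i hs fun v hv => ?_,
    inf_le_of_forall i i i (single_notMem_yElt i) hs (single_notMem_pElt i) fun v hv hv' => ?_⟩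
  all_goals simp [mem_yElt, mem_pElt, mem_qElt, mem_qsElt] at * <;> grind

variable [NeZero n]

theorem sum_eq_of_mem {i : ZMod n} {g : ZMod n → F} (h : ∀ j, j ≠ i - 1 → j ≠ i → g j = 0) :
    ∑ j, g j = g (i - 1) + g i := by
  have h1 : i - 1 ≠ i := by simpa using Haiman.one_ne_zero_zmod n
  exact Fintype.sum_eq_add _ _ h1 fun j hj => h j hj.1 hj.2

/-- Away from `i = 0`, the regluing does not affect `q_i + ⟨β_i - β_{i-1}⟩`. -/
theorem cElt_le_sumZero {i : ZMod n} (hi : i ≠ 0) : cElt (F := F) a i ≤ sumZero a := by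
  have h1 := Haiman.one_ne_zero_zmod n
  have h2 := Haiman.two_ne_zero_zmod n
  have h3 : i - 1 ≠ i := by simpa using h1
  have h4 : (-1 - 1 : ZMod n) ≠ 0 := fun h => h2 (by linear_combination -h)
  rw [le_iff_of_le coord_le_sumZero, Haiman.glue, if_neg (not_mem_le i (single_notMem_cElt i)),
    Haiman.twist, if_neg]
  · refine sup_le (fun v hv => ?_) coord_le_sumZero
    rw [mem_cElt] at hv
    rw [mem_sumZero, sum_eq_of_mem (g := fun j => v (Sum.inr j)) hv.2]
    exact hv.1.2
  -- If `β_i - β_{i-1}` lay in `s_0`, then `i` and `i - 1` would both be in `{-1, 0}`. With `i ≠ 0`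
  -- this gives `i = -1` and `-2 ∈ {-1, 0}`, impossible for `n ≥ 3`.
  · intro h
    let v : Haiman.Space F n :=
      fun k => if k = Sum.inr i then 1 else if k = Sum.inr (i - 1) then -1 else 0
    have hv : v ∈ (cElt a i).toSubmodule := by
      rw [mem_cElt]
      grind
    have hv' := h (Submodule.mem_sup_left hv)
    have hi' : i = -1 := by
      by_contra hi'
      have := hv' (Sum.inr i) (by simp [Haiman.sIdx, Haiman.mIdx, hi, hi'])
      simp [v] at this
    subst hi'
    have := hv' (Sum.inr (-1 - 1)) (by
      simp only [Haiman.sIdx, Haiman.mIdx]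
      simp
      grind)
    grind

/-- The regluing separates `q_0 + ⟨β_0 - β_{-1}⟩` from the hyperplane `sumZero`. -/
theorem cElt_inf_sumZero_le (ha : a ≠ 1) : cElt (F := F) a (0 : ZMod n) ⊓ sumZero a ≤ qElt a 0 := by
  have hc := single_notMem_cElt (F := F) (a := a) (0 : ZMod n)
  refine le_of_toSubmodule_le 0 (single_notMem_qElt 0) fun v hv => ?_
  have hle := toSubmodule_le 0 hc (inf_le_left : cElt a 0 ⊓ sumZero a ≤ cElt (F := F) a (0 : ZMod n))
  have hsum := (le_iff_of_le coord_le_sumZero).1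
    (inf_le_right : cElt (F := F) a (0 : ZMod n) ⊓ sumZero a ≤ sumZero a)
  -- Being inside `s_0` selects the branch of the twist that applies `scale`.
  have hle' : (cElt (F := F) a (0 : ZMod n) ⊓ sumZero a).toSubmodule ⊔
      Haiman.coord F n (Haiman.mIdx n) ≤ Haiman.coord F n (Haiman.sIdx n 0) := by
    refine sup_le (fun w hw => ?_) (Haiman.coord_mono F n Set.subset_union_left)
    have hw' := mem_cElt.1 (hle hw)
    rintro (j | j) hj
    · exact absurd (Or.inl ⟨j, rfl⟩) hj
    · exact hw'.2 j (fun h => hj (Or.inr (by simp [h]))) fun h => hj (Or.inr (by simp [h]))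
  rw [Haiman.glue, if_neg (fun h => not_mem_le 0 hc (h.trans hle)), Haiman.twist,
    if_pos hle'] at hsum
  have hs := mem_sumZero.1 (hsum (Submodule.mem_map_of_mem (Submodule.mem_sup_left hv)))
  have hv' := mem_cElt.1 (hle hv)
  have h1 : (0 - 1 : ZMod n) ≠ 0 := by simpa using Haiman.one_ne_zero_zmod n
  rw [sum_eq_of_mem (i := 0)] at hs
  -- Membership of the scaled vector in `sumZero` gives `v(β_{-1}) + a v(β_0) = 0`, whereas `cElt`
  -- gives `v(β_{-1}) + v(β_0) = 0`.
  · have h0 : ((a : F) - 1) * v (Sum.inr 0) = 0 := by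
      have e1 : Haiman.scale F n a v (Sum.inr (0 - 1)) = v (Sum.inr (0 - 1)) :=
        if_neg (by simpa using h1)
      have e2 : Haiman.scale F n a v (Sum.inr 0) = a * v (Sum.inr 0) := if_pos rfl
      rw [e1, e2] at hs
      linear_combination hs - hv'.1.2
    have h0' : v (Sum.inr 0) = 0 := by
      refine (mul_eq_zero.1 h0).resolve_left fun h => ha (Units.ext ?_)
      simpa [sub_eq_zero] using h
    have h00 := hv'.1.2
    rw [h0', add_zero] at h00
    exact mem_qElt.2 ⟨⟨hv'.1.1, h00, h0'⟩, hv'.2⟩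
  · intro j hj hj'
    have : Haiman.scale F n a v (Sum.inr j) = v (Sum.inr j) := if_neg (by simpa using hj')
    rw [this, hv'.2 j hj hj']

end Elements

/-! ### The cycle argument in Haiman's lattices and the conclusion. -/

theorem not_injective_of_latticeHom {S : FirstOrder.Language.{u, v}} {A : Type w}
    [S.Structure A] {d : S.Term (Fin 3)} (hd : IsWeakDifferenceTerm d A) (F : Type x) [Field F]
    (n : ℕ) [hn : Fact (3 ≤ n)] (a : Fˣ) (ha : a ≠ 1)
    (f : LatticeHom (HaimanLattice F n a) (AlgCon S A)) : ¬ Function.Injective f := by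
  intro hf
  have : NeZero n := ⟨by have := hn.out; omega⟩
  have hmono : Monotone f := OrderHomClass.mono f
  suffices H : f (diagonal a n) ≤ f (pElt a 0) by
    refine not_diagonal_le_pElt (a := a) (0 : ZMod n) (inf_eq_left.1 (hf ?_))
    rw [map_inf]
    exact inf_eq_left.2 H
  intro p r hpr
  have hz : ∀ i : ZMod n, ∃ q, (f (xElt a i)).toSetoid p q ∧ (f (yElt a i)).toSetoid q r :=
    fun i => hd.exists_of_map_sup_rel f (xElt_inf_yElt i) (tElt_inf_xElt i) (tElt_inf_yElt i)
      (xElt_le_sup i) (yElt_le_sup i) (hmono (diagonal_le_sup i) hpr)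
  choose z hpz hzr using hz
  -- The path through `p` uses only the `x`-points and the path through `r` only the `y`-points.
  have hc : ∀ i, (f (cElt a i)).toSetoid (z (i - 1)) (z i) := by
    intro i
    obtain ⟨s, t, h₁, h₂, h₃, h₄, h₅⟩ := exists_cElt_bounds (a := a) i
    exact map_inf_rel f h₅
      ((f s).toSetoid.trans' ((f s).toSetoid.symm' (hmono h₂ (hpz (i - 1)))) (hmono h₁ (hpz i)))
      ((f t).toSetoid.trans' (hmono h₄ (hzr (i - 1))) ((f t).toSetoid.symm' (hmono h₃ (hzr i))))
  -- The walk stops at `n - 1`, so it never uses the step from `z (-1)` to `z 0`, the only one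
  -- affected by the twist.
  have hsum : ∀ k < n, (f (sumZero a)).toSetoid (z 0) (z (k : ZMod n)) := by
    intro k
    induction k with
    | zero => simp
    | succ k ih =>
      intro hk
      have hk0 : ((k + 1 : ℕ) : ZMod n) ≠ 0 := by
        rw [Ne, ZMod.natCast_eq_zero_iff]
        exact fun h => absurd (Nat.le_of_dvd (by omega) h) (by omega)
      have := hmono (cElt_le_sumZero hk0) (hc ((k + 1 : ℕ) : ZMod n))
      rw [show ((k + 1 : ℕ) : ZMod n) - 1 = k by push_cast; ring] at this
      exact (f (sumZero a)).toSetoid.trans' (ih (by omega)) this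
  -- The cycle closes because `n - 1` is `0 - 1` modulo `n`: the omitted step is related both by
  -- `cElt a 0` and by `sumZero a`.
  have hq : (f (qElt a 0)).toSetoid (z (0 - 1)) (z 0) := by
    refine map_inf_rel f (cElt_inf_sumZero_le ha) (hc 0) ((f (sumZero a)).toSetoid.symm' ?_)
    have := hsum (n - 1) (by have := hn.out; omega)
    rwa [Nat.cast_sub (by have := hn.out; omega), ZMod.natCast_self, Nat.cast_one] at this
  obtain ⟨s, hs₁, hs₂, hs₃⟩ := exists_xElt_bound (F := F) (a := a) (0 : ZMod n)
  obtain ⟨t, ht₁, ht₂, ht₃⟩ := exists_yElt_bound (F := F) (a := a) (0 : ZMod n)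
  -- Both halves of the path `p`, `z 0`, `r` are compared with the detour through `z (-1)`, which
  -- puts each of them in the congruence of `p_0`.
  exact (f (pElt a 0)).toSetoid.trans'
    (map_inf_rel f hs₃ (hpz 0)
      ((f s).toSetoid.trans' (hmono hs₁ (hpz _)) (hmono hs₂ hq)))
    (map_inf_rel f ht₃ (hzr 0)
      ((f t).toSetoid.trans' ((f t).toSetoid.symm' (hmono ht₂ hq)) (hmono ht₁ (hzr _))))

end HaimanLattice

/-- Let `𝒱` be a variety of algebras (axiomatized by the equations `E`) with a weak difference
term. Then neither any of Haiman's lattices nor the lattice of subspaces of any non-Desarguesian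
projective plane belongs to `S Con(𝒱)`. -/
theorem mainTheorem6 {S : FirstOrder.Language.{u, v}} [S.IsAlgebraic]
    (E : Set (S.Term ℕ × S.Term ℕ)) (hE : HasWeakDifferenceTerm.{u, v, w} E) :
    (∀ (F : Type x) [Field F] (n : ℕ) [Fact (3 ≤ n)] (a : Fˣ), a ≠ 1 →
      ¬ InSCon.{u, v, w} E (HaimanLattice F n a)) ∧
    (∀ (P : Type y) (Λ : Type z) [Membership P Λ] [Configuration.ProjectivePlane P Λ],
      ¬ IsDesarguesian P Λ → ¬ InSCon.{u, v, w} E (PlaneSubspace P Λ)) := by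
  obtain ⟨d, hd⟩ := hE
  refine ⟨?_, ?_⟩
  · rintro F _ n _ a ha ⟨A, _, hA, f, hf⟩
    exact HaimanLattice.not_injective_of_latticeHom (hd A hA) F n a ha f hf
  · rintro P Λ _ _ hP ⟨A, _, hA, f, hf⟩
    exact hP (isDesarguesian_of_latticeHom (hd A hA) P Λ f hf)
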